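/- Let $\mathrm{UOSp}(1|2)$ have the coordinates $(g,\bar\eta,\eta)\mapsto g\cdot\exp(\bar\eta V_++\eta V_-)$ with $g\in\mathrm{SU}(2)$ and odd generators $\bar\eta,\eta$. Its invariant integral is $\int_{\mathrm{UOSp}(1|2)}=\int_{\mathrm{SU}(2)}d\sigma\int d\bar\eta\,d\eta\,(1-\tfrac14\bar\eta\eta)$, where $d\sigma$ is four times the normalized Haar measure of $\mathrm{SU}(2)$ and $\int d\bar\eta\,d\eta\,\bar\eta\eta=-1$. Put $\mathscr S(f|h)=\int_{\mathrm{UOSp}(1|2)}\bar f h$, with the conjugation that is antilinear and multiplicative and satisfies $\bar{\bar\alpha}=(-1)^{|\alpha|}\alpha$. For $j\in\frac12\mathbb N_0$ let $\pi_j$ be the irreducible representation of $\mathrm{UOSp}(1|2)$ on $V_j\oplus\Pi V_{j-1/2}$, whose even part is the spin-$j$ and whose odd part is the spin-$(j-\frac12)$ representation of $\mathrm{SU}(2)$. Let $\chi_j=\mathrm{str}\,\pi_j$ be its super character and $d_j=4j+1$ its (ungraded) dimension. Consider $n_l$ punctures of spin $j_l\in\frac12\mathbb N_0$ for $l=1,\dots,p$,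 and let $n=\sum_l n_l$. In the limit $k\to\infty$ the Chern–Simons states on the punctured sphere are the $\mathrm{UOSp}(1|2)$-invariant vectors in the graded tensor product $\bigotimes_{l=1}^p\pi_{j_l}^{\otimes n_l}$. Let $\mathcal N_\infty(\{n_l,j_l\})$ be the number of these invariant states counted with parity, that is, the dimension of the space of even invariant vectors minus the dimension of the space of odd invariant vectors. Then $$\mathcal N_\infty(\{n_l,j_l\})=\mathscr S\Big(\chi_0\,\Big|\,\prod_{l=1}^p(\chi_{j_l})^{n_l}\Big)=\int_{\mathrm{UOSp}(1|2)}\prod_{l=1}^p(\chi_{j_l})^{n_l},$$ and $$\mathcal N_\infty(\{n_l,j_l\})=\frac2\pi\Big(1-\frac n4\Big)\int_0^\pi d\theta\,\sin^2(2\theta)\prod_{l=1}^p\Big(\frac{\cos(d_{j_l}\theta)}{\cos\theta}\Big)^{n_l}+\frac1{2\pi}\sum_{l=1}^p n_l\,d_{j_l}\int_0^\pi d\theta\,\sin^2(2\theta)\,\frac{\sin(d_{j_l}\theta)}{\sin\theta}\Big(\frac{\cos(d_{j_l}\theta)}{\cos\theta}\Big)^{n_l-1}\prod_{i\ne l}\Big(\frac{\cos(d_{j_i}\theta)}{\cos\theta}\Big)^{n_i},$$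 where all the integrals over $[0,\pi]$ converge. Moreover, the dimension of the space of all invariant vectors in the tensor product (the plain number of invariant states) equals $(-1)^{2\sum_l n_lj_l}\,\mathcal N_\infty(\{n_l,j_l\})$. In particular it is given by the same integral formula whenever $\sum_l n_lj_l$ is an integer. -/

import Mathlib

open scoped BigOperators

noncomputable section

namespace UOSp

/-! ### The Grassmann algebra on the two odd generators -/

/-- The complex Grassmann algebra on two odd generators `etaBar`, `eta`. -/
abbrev Grassmann : Type := ExteriorAlgebra ℂ (Fin 2 → ℂ)

/-- The odd generator `η̄`. -/
def etaBar : Grassmann := ExteriorAlgebra.ι ℂ ![1, 0]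

/-- The odd generator `η`. -/
def eta : Grassmann := ExteriorAlgebra.ι ℂ ![0, 1]

/-- The coefficient of `η̄ η` in the expansion of `x` in the basis `1, η̄, η, η̄ η`. -/
def topCoeff : Grassmann →ₗ[ℂ] ℂ :=
  ExteriorAlgebra.liftAlternating (R := ℂ) (M := Fin 2 → ℂ) (N := ℂ)
    (Pi.single 2 (Matrix.detRowAlternating : (Fin 2 → ℂ) [⋀^Fin 2]→ₗ[ℂ] ℂ))

/-- The Berezin integral `∫_B dη̄ dη`: the iterated odd derivative `∂_η̄ ∂_η`. It sends `η̄ η` to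
`-1` and `1, η̄, η` to `0`. -/
def berezin : Grassmann →ₗ[ℂ] ℂ := -topCoeff

/-- The conjugation of the Grassmann algebra: the antilinear multiplicative map with `η ↦ η̄` and
`η̄ ↦ -η` (so that conjugating twice is `(-1)^|x|`); in coordinates,
`a + b η̄ + c η + d η̄ η ↦ a* + c* η̄ - b* η + d* η̄ η`. -/
def conj (x : Grassmann) : Grassmann :=
  algebraMap ℂ Grassmann (star (ExteriorAlgebra.algebraMapInv x))
    + ExteriorAlgebra.ι ℂ
        ![star (ExteriorAlgebra.ιInv x 1), -star (ExteriorAlgebra.ιInv x 0)]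
    + star (topCoeff x) • (etaBar * eta)

/-! ### Functions on the supergroup and the invariant integral -/

/-- The group `SU(2)`. -/
abbrev SU2 : Type := Matrix.specialUnitaryGroup (Fin 2) ℂ

/-- Functions on `UOSp(1|2)`: through the splitting `(g, X) ↦ g · exp X` with
`X = η̄ V₊ + η V₋`, these are the functions on `SU(2)` with values in the Grassmann algebra. -/
abbrev SuperFunction : Type := SU2 → Grassmann

/-- `exp(φ T₃) exp(ϑ T₂) exp(ψ T₃)` as a matrix, where `T₃ = -i J₃` and `T₂ = (J₊ - J₋)/2`. -/
def eulerMatrix (φ ϑ ψ : ℝ) : Matrix (Fin 2) (Fin 2) ℂ :=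
  !![Complex.exp (-(φ / 2 : ℝ) * Complex.I), 0; 0, Complex.exp ((φ / 2 : ℝ) * Complex.I)]
    * !![(Real.cos (ϑ / 2) : ℂ), (Real.sin (ϑ / 2) : ℂ);
         -(Real.sin (ϑ / 2) : ℂ), (Real.cos (ϑ / 2) : ℂ)]
    * !![Complex.exp (-(ψ / 2 : ℝ) * Complex.I), 0; 0, Complex.exp ((ψ / 2 : ℝ) * Complex.I)]

theorem diag_mem (x : ℝ) :
    !![Complex.exp (-(x : ℂ) * Complex.I), 0; 0, Complex.exp ((x : ℂ) * Complex.I)]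
      ∈ Matrix.specialUnitaryGroup (Fin 2) ℂ := by
  rw [Matrix.mem_specialUnitaryGroup_iff, Matrix.mem_unitaryGroup_iff]
  constructor
  · ext i j
    fin_cases i <;> fin_cases j <;>
      simp [Matrix.mul_apply, Fin.sum_univ_two, Matrix.star_eq_conjTranspose,
        Matrix.conjTranspose_apply, ← Complex.exp_conj, ← Complex.exp_add]
  · simp [Matrix.det_fin_two, ← Complex.exp_add]

theorem rot_mem (x : ℝ) :
    !![(Real.cos x : ℂ), (Real.sin x : ℂ); -(Real.sin x : ℂ), (Real.cos x : ℂ)]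
      ∈ Matrix.specialUnitaryGroup (Fin 2) ℂ := by
  have h : (Real.cos x : ℂ) * Real.cos x + (Real.sin x : ℂ) * Real.sin x = 1 := by
    have := Real.cos_sq_add_sin_sq x
    rw [← sq, ← sq]
    exact_mod_cast this
  rw [Matrix.mem_specialUnitaryGroup_iff, Matrix.mem_unitaryGroup_iff]
  constructor
  · ext i j
    fin_cases i <;> fin_cases j <;>
      simp only [Matrix.mul_apply, Fin.sum_univ_two, Matrix.star_eq_conjTranspose,
        Matrix.conjTranspose_apply, Fin.zero_eta, Fin.mk_one, Matrix.of_apply,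
        Matrix.cons_val', Matrix.cons_val_zero, Matrix.cons_val_one, Matrix.cons_val_fin_one,
        map_neg, RCLike.star_def, Complex.conj_ofReal, Matrix.one_apply_eq, ne_eq,
        zero_ne_one, one_ne_zero, not_false_eq_true, Matrix.one_apply_ne]
    · exact h
    · ring
    · ring
    · linear_combination h
  · rw [Matrix.det_fin_two_of]
    linear_combination h

/-- The element of `SU(2)` with Euler angles `φ, ϑ, ψ`. -/
def euler (φ ϑ ψ : ℝ) : SU2 :=
  ⟨eulerMatrix φ ϑ ψ,
    mul_mem (mul_mem (diag_mem (φ / 2)) (rot_mem (ϑ / 2))) (diag_mem (ψ / 2))⟩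

/-- The integral `∫_{S³} dσ` over `SU(2)`, with `dσ = (4π²)⁻¹ sin ϑ dφ dϑ dψ` in Euler
coordinates, that is, four times the normalized invariant measure. -/
def integralSU2 (F : SU2 → ℂ) : ℂ :=
  (1 / (4 * (Real.pi : ℂ) ^ 2)) *
    ∫ φ in (0 : ℝ)..(2 * Real.pi), ∫ ϑ in (0 : ℝ)..Real.pi, ∫ ψ in (0 : ℝ)..(4 * Real.pi),
      (Real.sin ϑ : ℂ) * F (euler φ ϑ ψ)

/-- The invariant integral on `UOSp(1|2)`:
`∫ f = ∫_{S³} dσ ∫_B dη̄ dη (1 - ¼ η̄ η) f`. -/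
def integral (f : SuperFunction) : ℂ :=
  integralSU2 fun g => berezin ((1 - (1 / 4 : ℂ) • (etaBar * eta)) * f g)

/-- The super scalar product `𝒮(f|h) = ∫ f̄ h`. -/
def superScalar (f h : SuperFunction) : ℂ :=
  integral fun g => conj (f g) * h g

/-! ### The irreducible representations -/

/-- The matrix of `g ∈ SU(2)` in the irreducible representation of dimension `N` (spin
`j = (N - 1) / 2`), on the homogeneous polynomials of degree `N - 1 = 2j` in `x, y`, in the
orthonormal basis `|j, m⟩ = x^(j+m) y^(j-m) / √((j+m)! (j-m)!)`. The index `k` stands for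
`m = k - j`, and `g` acts by `x ↦ g₀₀ x + g₁₀ y`, `y ↦ g₀₁ x + g₁₁ y` (polynomials are
dehomogenized at `y = 1`). -/
def wignerD (N : ℕ) (g : SU2) : Matrix (Fin N) (Fin N) ℂ :=
  let M : Matrix (Fin 2) (Fin 2) ℂ := g
  fun k' k =>
    ((Real.sqrt ((k' : ℕ).factorial * (N - 1 - (k' : ℕ)).factorial)
        / Real.sqrt ((k : ℕ).factorial * (N - 1 - (k : ℕ)).factorial) : ℝ) : ℂ) *
      ((Polynomial.C (M 0 0) * Polynomial.X + Polynomial.C (M 1 0)) ^ (k : ℕ)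
        * (Polynomial.C (M 0 1) * Polynomial.X + Polynomial.C (M 1 1)) ^ (N - 1 - (k : ℕ))).coeff k'

/-- Basis of the representation `π_j`, with `a = 2j`: the even vectors `|j, m⟩`
(`Sum.inl k`, `m = k - j`) and the odd vectors `|j - 1/2, m⟩` (`Sum.inr r`,
`m = r - (j - 1/2)`). -/
abbrev Idx (a : ℕ) : Type := Fin (a + 1) ⊕ Fin a

/-- The odd generator `V₊` of `osp(1|2)` in `π_j`, `a = 2j`:
`|j, m⟩ ↦ -½ √(j-m) |j-½, m+½⟩` and `|j-½, m⟩ ↦ -½ √(j+m+½) |j, m+½⟩`. -/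
def Vplus (a : ℕ) : Matrix (Idx a) (Idx a) ℂ
  | Sum.inr r, Sum.inl k =>
      if (k : ℕ) = r then -(1 / 2) * (Real.sqrt ((a : ℝ) - (k : ℕ)) : ℂ) else 0
  | Sum.inl k, Sum.inr r =>
      if (k : ℕ) = r + 1 then -(1 / 2) * (Real.sqrt ((r : ℕ) + 1) : ℂ) else 0
  | Sum.inl _, Sum.inl _ => 0
  | Sum.inr _, Sum.inr _ => 0

/-- The odd generator `V₋` of `osp(1|2)` in `π_j`, `a = 2j`:
`|j, m⟩ ↦ ½ √(j+m) |j-½, m-½⟩` and `|j-½, m⟩ ↦ -½ √(j-m+½) |j, m-½⟩`. -/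
def Vminus (a : ℕ) : Matrix (Idx a) (Idx a) ℂ
  | Sum.inr r, Sum.inl k =>
      if (k : ℕ) = r + 1 then (1 / 2) * (Real.sqrt (k : ℕ) : ℂ) else 0
  | Sum.inl k, Sum.inr r =>
      if (k : ℕ) = r then -(1 / 2) * (Real.sqrt ((a : ℝ) - (r : ℕ)) : ℂ) else 0
  | Sum.inl _, Sum.inl _ => 0
  | Sum.inr _, Sum.inr _ => 0

/-- The odd algebra element `η̄ V₊ + η V₋` in `π_j`, `a = 2j`. -/
def oddElement (a : ℕ) : Matrix (Idx a) (Idx a) Grassmann :=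
  (Vplus a).map (fun z => z • etaBar) + (Vminus a).map (fun z => z • eta)

/-- A super vector space with a finite homogeneous basis, together with a square matrix, in this
basis, of functions on `UOSp(1|2)`. Matrix entries act from the right: `e_i ↦ ∑ₖ e_k M_{ki}`. -/
structure SuperMatrix where
  /-- the index set of the homogeneous basis -/
  ι : Type
  [fintype : Fintype ι]
  [decEq : DecidableEq ι]
  /-- the parity of each basis vector -/
  parity : ι → ZMod 2
  /-- the matrix at `g · exp(η̄ V₊ + η V₋)` -/
  mat : SU2 → Matrix ι ι Grassmann

attribute [instance] SuperMatrix.fintype SuperMatrix.decEq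

/-- The finite-dimensional irreducible representation `π_j` of `UOSp(1|2)`, where `a = 2j`, on
`V_j ⊕ Π V_{j-1/2}`: `π_j(g · exp X) = (D^j(g) ⊕ D^{j-1/2}(g)) · exp(π_j(X))`,
`X = η̄ V₊ + η V₋`. The exponential is a finite sum because `X` is nilpotent. -/
def irrep (a : ℕ) : SuperMatrix where
  ι := Idx a
  parity := Sum.elim (fun _ => 0) (fun _ => 1)
  mat := fun g =>
    (Matrix.fromBlocks (wignerD (a + 1) g) 0 0 (wignerD a g)).map (algebraMap ℂ Grassmann)
      * IsNilpotent.exp (oddElement a)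

/-- The sign `(-1)^s`. -/
def sgn (s : ZMod 2) : ℂ := if s = 0 then 1 else -1

/-- The graded tensor product: `M_{ca}` is moved past the basis vector `e_d` of the second factor
in `(e_a ⊗ e_b) ↦ ∑ (e_c M_{ca}) ⊗ (e_d M'_{db})`, which gives the sign `(-1)^{|d|(|a|+|c|)}`. -/
def SuperMatrix.tensor (R S : SuperMatrix) : SuperMatrix where
  ι := R.ι × S.ι
  parity := fun i => R.parity i.1 + S.parity i.2
  mat := fun g i k =>
    sgn (S.parity i.2 * (R.parity i.1 + R.parity k.1)) • (R.mat g i.1 k.1 * S.mat g i.2 k.2)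

/-- The graded tensor product `π_{j₁} ⊗ ⋯ ⊗ π_{jₙ}` over a list of doubled spins (the trivial
representation `π_0` for the empty list). -/
def tensorList (l : List ℕ) : SuperMatrix :=
  l.foldr (fun a R => (irrep a).tensor R) (irrep 0)

/-- The list of punctures: `n l` punctures of spin `j_l = a l / 2` for each `l`. -/
def punctures {p : ℕ} (a n : Fin p → ℕ) : List ℕ :=
  (List.ofFn fun l => List.replicate (n l) (a l)).flatten

/-- The supertrace of the matrix, a function on `UOSp(1|2)`. -/
def SuperMatrix.superTrace (R : SuperMatrix) : SuperFunction :=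
  fun g => ∑ i, sgn (R.parity i) • R.mat g i i

/-- The super character `χ_j = str π_j`, where `a = 2j`. -/
def superCharacter (a : ℕ) : SuperFunction := (irrep a).superTrace

/-- The product `∏_l (χ_{j_l})^{n_l}`, with `j_l = a l / 2`. -/
def characterProduct {p : ℕ} (a n : Fin p → ℕ) : SuperFunction :=
  (List.ofFn fun l => superCharacter (a l) ^ n l).prod

/-! ### Invariant states -/

/-- The invariant states: the vectors `v` that are fixed by every element
`g · exp(η̄ V₊ + η V₋)` of the supergroup. -/
def SuperMatrix.invariants (R : SuperMatrix) : Submodule ℂ (R.ι → ℂ) where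
  carrier := {v | ∀ g : SU2,
    (R.mat g).mulVec (fun i => algebraMap ℂ Grassmann (v i)) = fun i => algebraMap ℂ Grassmann (v i)}
  zero_mem' := by
    intro g
    ext i
    simp [Matrix.mulVec, dotProduct]
  add_mem' := by
    intro v w hv hw g
    have h : (fun i => algebraMap ℂ Grassmann ((v + w) i))
        = (fun i => algebraMap ℂ Grassmann (v i)) + fun i => algebraMap ℂ Grassmann (w i) := by
      ext i
      simp
    rw [h, Matrix.mulVec_add, hv g, hw g]
  smul_mem' := by
    intro c v hv g
    have h : (fun i => algebraMap ℂ Grassmann ((c • v) i))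
        = c • fun i => algebraMap ℂ Grassmann (v i) := by
      ext i
      simp [Algebra.smul_def]
    rw [h, Matrix.mulVec_smul, hv g]

/-- The vectors that are homogeneous of parity `s`. -/
def SuperMatrix.homogeneous (R : SuperMatrix) (s : ZMod 2) : Submodule ℂ (R.ι → ℂ) where
  carrier := {v | ∀ i, R.parity i ≠ s → v i = 0}
  zero_mem' := fun _ _ => rfl
  add_mem' := by
    intro v w hv hw i hi
    simp [hv i hi, hw i hi]
  smul_mem' := by
    intro c v hv i hi
    simp [hv i hi]

/-- The number of invariant states: the dimension of the space of invariant vectors, that is, the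
number of independent trivial subrepresentations, of either parity. -/
def SuperMatrix.numInvariants (R : SuperMatrix) : ℕ := Module.finrank ℂ R.invariants

/-- The number of invariant states counted with parity: even ones minus odd ones. -/
def SuperMatrix.superNumInvariants (R : SuperMatrix) : ℤ :=
  (Module.finrank ℂ (R.invariants ⊓ R.homogeneous 0 : Submodule ℂ (R.ι → ℂ)) : ℤ)
    - Module.finrank ℂ (R.invariants ⊓ R.homogeneous 1 : Submodule ℂ (R.ι → ℂ))

/-! ### The integral formula -/

/-- `d_j = 4j + 1` for `a = 2j`. -/
def dimRep (a : ℕ) : ℝ := 2 * a + 1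

/-- The first integrand `sin²(2θ) ∏_l (cos(d_l θ) / cos θ)^{n_l}`. -/
def mainIntegrand {p : ℕ} (a n : Fin p → ℕ) (θ : ℝ) : ℝ :=
  Real.sin (2 * θ) ^ 2 * ∏ l, (Real.cos (dimRep (a l) * θ) / Real.cos θ) ^ n l

/-- The `l`-th integrand of the correction sum:
`sin²(2θ) (sin(d_l θ) / sin θ) (cos(d_l θ) / cos θ)^{n_l - 1} ∏_{i ≠ l} (cos(d_i θ) / cos θ)^{n_i}`.
It is multiplied by `n_l`, so that the exponent `n_l - 1` matters only for `n_l ≥ 1`. -/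
def correctionIntegrand {p : ℕ} (a n : Fin p → ℕ) (l : Fin p) (θ : ℝ) : ℝ :=
  Real.sin (2 * θ) ^ 2 * (Real.sin (dimRep (a l) * θ) / Real.sin θ)
    * (Real.cos (dimRep (a l) * θ) / Real.cos θ) ^ (n l - 1)
    * ∏ i ∈ Finset.univ.erase l, (Real.cos (dimRep (a i) * θ) / Real.cos θ) ^ n i

/-- The right-hand side of the Verlinde-type formula, with `n = ∑_l n_l`. -/
def verlindeIntegral {p : ℕ} (a n : Fin p → ℕ) : ℝ :=
  2 / Real.pi * (1 - (∑ l, (n l : ℝ)) / 4) * (∫ θ in (0 : ℝ)..Real.pi, mainIntegrand a n θ)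
    + 1 / (2 * Real.pi) * ∑ l, (n l : ℝ) * dimRep (a l)
        * ∫ θ in (0 : ℝ)..Real.pi, correctionIntegrand a n l θ

end UOSp

end

/-! Two numbers are computed independently and reduced to the same integral over the torus.

Counting. A representation is encoded by a `Realization`: its `SU(2)` action together with the odd
generators V₊, V₋, which satisfy {V₊, V₋} = -H/4 with H = 2J₃. Such data pass to graded tensor
products. A vector is invariant exactly when V₊ and V₋ annihilate it (`mem_invariants_iff`). The
squares V₊² and V₋² are multiples of the raising and lowering operators of su(2) and satisfy (V₊²)*
= -V₋². A positivity argument then shows that V₊ maps the weight space W₀ onto W₁ and that its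
kernel in W₀ is the space of invariants, so their number is dim W₀ - dim W₁ (`numInvariants_add`).
Parity equals weight plus a constant mod 2, so all invariants share one parity, and the signed sum
of the multiplicities of the weights 0 and 1 is the signed count. By orthogonality of exponentials
this is (2/π) ∫ cos²θ P(θ) dθ, where P is the product of the torus super characters cos(dθ)/cos θ
(`superNumInvariants_eq_integral`).

Integrating. The super character is B + S η̄η, where B and S are Chebyshev polynomials in the trace
(`superCharacter_eq`). Products are taken in the dual numbers, so the soul of a product obeys the
Leibniz rule. The Berezin integral with density 1 - η̄η/4 leaves body/4 - soul, and the Weyl formula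
(`integralSU2_eq`) turns the group integral into (8/π) ∫ sin²(2θ) (P/4 - soul) dθ. Expanding the
soul gives the stated trigonometric formula (`integral_eq_verlindeIntegral`).

Comparing. On the torus, cos θ · B' = 16 sin θ · S, and the same holds for products. Hence sin θ
cos³θ P is a primitive of cos²θ P - 4 sin²(2θ)(P/4 - soul). It vanishes at 0 and π, so the two
integrals agree (`integral_eq_integral_cos_sq`). -/

noncomputable section

namespace UOSp

open Matrix
open scoped Kronecker Real

/-! ### The Grassmann algebra -/

theorem etaBar_mul_self : etaBar * etaBar = 0 := ExteriorAlgebra.ι_sq_zero _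

theorem eta_mul_self : eta * eta = 0 := ExteriorAlgebra.ι_sq_zero _

theorem eta_mul_etaBar : eta * etaBar = -(etaBar * eta) :=
  eq_neg_of_add_eq_zero_left (ExteriorAlgebra.ι_add_mul_swap _ _)

theorem topCoeff_algebraMap (z : ℂ) : topCoeff (algebraMap ℂ Grassmann z) = 0 := by
  rw [topCoeff, ExteriorAlgebra.liftAlternating_algebraMap]
  simp

theorem topCoeff_one : topCoeff 1 = 0 := by
  rw [← map_one (algebraMap ℂ Grassmann), topCoeff_algebraMap]

theorem topCoeff_etaBar_mul_eta : topCoeff (etaBar * eta) = 1 := by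
  have h : etaBar * eta = ExteriorAlgebra.ιMulti ℂ 2 ![![1, 0], ![0, 1]] := by
    simp [ExteriorAlgebra.ιMulti_apply, etaBar, eta]
  rw [h, topCoeff, ExteriorAlgebra.liftAlternating_apply_ιMulti]
  simp only [Pi.single_eq_same]
  exact (Matrix.det_fin_two _).trans (by simp)

theorem ιInv_algebraMap (z : ℂ) :
    ExteriorAlgebra.ιInv (algebraMap ℂ Grassmann z) = (0 : Fin 2 → ℂ) := by
  simp [ExteriorAlgebra.ιInv, TrivSqZeroExt.algebraMap_eq_inl]

theorem ιInv_one : ExteriorAlgebra.ιInv (1 : Grassmann) = (0 : Fin 2 → ℂ) := by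
  rw [← map_one (algebraMap ℂ Grassmann), ιInv_algebraMap]

theorem ιInv_etaBar : ExteriorAlgebra.ιInv etaBar = (![1, 0] : Fin 2 → ℂ) :=
  ExteriorAlgebra.ι_leftInverse _

theorem ιInv_eta : ExteriorAlgebra.ιInv eta = (![0, 1] : Fin 2 → ℂ) :=
  ExteriorAlgebra.ι_leftInverse _

/-- `ιInv` factors through the trivial square-zero extension, where a product of two degree-one
elements vanishes. -/
theorem ιInv_ι_mul_ι {R M : Type*} [CommRing R] [AddCommGroup M] [Module R M] (x y : M) :
    ExteriorAlgebra.ιInv (ExteriorAlgebra.ι R x * ExteriorAlgebra.ι R y) = (0 : M) := by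
  simp [ExteriorAlgebra.ιInv]

theorem ιInv_etaBar_mul_eta : ExteriorAlgebra.ιInv (etaBar * eta) = (0 : Fin 2 → ℂ) :=
  ιInv_ι_mul_ι _ _

theorem conj_one : conj 1 = 1 := by
  have h1 : ExteriorAlgebra.algebraMapInv (1 : Grassmann) = 1 := map_one _
  have h2 : (![star ((0 : Fin 2 → ℂ) 1), -star ((0 : Fin 2 → ℂ) 0)] : Fin 2 → ℂ) = 0 := by
    ext i; fin_cases i <;> simp
  rw [conj, h1, ιInv_one, h2, topCoeff_one]
  simp

/-! ### Matrices with Grassmann coefficients -/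

/-- The Grassmann-valued matrix `A x`, for a complex matrix `A`. -/
def scaled {m n : Type*} (A : Matrix m n ℂ) (x : Grassmann) : Matrix m n Grassmann :=
  A.map fun z => z • x

theorem scaled_apply {m n : Type*} (A : Matrix m n ℂ) (x : Grassmann) (i : m) (j : n) :
    scaled A x i j = A i j • x := rfl

theorem scaled_mul {m n o : Type*} [Fintype n] (A : Matrix m n ℂ) (B : Matrix n o ℂ)
    (x y : Grassmann) : scaled A x * scaled B y = scaled (A * B) (x * y) := by
  ext i j
  simp [scaled, Matrix.mul_apply, Finset.sum_smul, smul_smul, mul_comm]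

theorem scaled_zero_right {m n : Type*} (A : Matrix m n ℂ) : scaled A 0 = 0 := by
  ext i j; simp [scaled]

theorem scaled_neg_right {m n : Type*} (A : Matrix m n ℂ) (x : Grassmann) :
    scaled A (-x) = scaled (-A) x := by
  ext i j; simp [scaled]

theorem scaled_add {m n : Type*} (A B : Matrix m n ℂ) (x : Grassmann) :
    scaled (A + B) x = scaled A x + scaled B x := by
  ext i j; simp [scaled, add_smul]

theorem scaled_one {m : Type*} [DecidableEq m] : scaled (1 : Matrix m m ℂ) 1 = 1 := by
  ext i j
  rw [scaled_apply, Matrix.one_apply, Matrix.one_apply]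
  split_ifs <;> simp

theorem map_algebraMap_eq_scaled {m n : Type*} (A : Matrix m n ℂ) :
    A.map (algebraMap ℂ Grassmann) = scaled A 1 := by
  ext i j
  simp [scaled, Algebra.algebraMap_eq_smul_one]

/-- The expansion of `exp (η̄ A + η B)` in the Grassmann generators. -/
theorem exp_odd {m : Type} [Fintype m] [DecidableEq m] (A B : Matrix m m ℂ) :
    IsNilpotent.exp (scaled A etaBar + scaled B eta)
      = scaled 1 1 + scaled A etaBar + scaled B eta
        + scaled ((1 / 2 : ℂ) • (A * B - B * A)) (etaBar * eta) := by
  -- The complex entries commute with η̄ and η, so the sign comes only from ηη̄ = -η̄η and the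
  -- square produces a commutator.
  have h2 : (scaled A etaBar + scaled B eta) ^ 2 = scaled (A * B - B * A) (etaBar * eta) := by
    rw [sq, add_mul, mul_add, mul_add]
    simp only [scaled_mul, etaBar_mul_self, eta_mul_self, eta_mul_etaBar, scaled_zero_right,
      scaled_neg_right, zero_add, add_zero, ← scaled_add]
    rw [← sub_eq_add_neg]
  have h3 : (scaled A etaBar + scaled B eta) ^ 3 = 0 := by
    rw [pow_succ, h2, mul_add, scaled_mul, scaled_mul]
    have e1 : etaBar * eta * etaBar = 0 := by
      rw [mul_assoc, eta_mul_etaBar, mul_neg, ← mul_assoc, etaBar_mul_self, zero_mul, neg_zero]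
    have e2 : etaBar * eta * eta = 0 := by rw [mul_assoc, eta_mul_self, mul_zero]
    rw [e1, e2, scaled_zero_right, scaled_zero_right, add_zero]
  rw [IsNilpotent.exp_eq_sum h3, Finset.sum_range_succ, Finset.sum_range_succ,
    Finset.sum_range_one, h2, scaled_one]
  have e1 : ((Nat.factorial 1 : ℚ))⁻¹ = 1 := by norm_num
  have e2 : ((Nat.factorial 2 : ℚ))⁻¹ = 1 / 2 := by norm_num
  -- The nilpotent exponential has rational coefficients; they are turned into complex scalars.
  have e3 : ∀ x : Grassmann, (1 / 2 : ℚ) • x = (1 / 2 : ℂ) • x := by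
    intro x
    rw [← Rat.cast_smul_eq_qsmul ℂ]
    norm_num
  have e4 : (1 / 2 : ℚ) • scaled (A * B - B * A) (etaBar * eta)
      = scaled ((1 / 2 : ℂ) • (A * B - B * A)) (etaBar * eta) := by
    ext i j
    rw [Matrix.smul_apply, scaled_apply, scaled_apply, Matrix.smul_apply, smul_assoc, e3]
  rw [e1, e2, e4]
  simp only [Nat.factorial, pow_zero, pow_one, Nat.cast_one, inv_one, one_smul]
  abel

/-! ### One-parameter subgroups and infinitesimal data -/

/-- The diagonal one-parameter subgroup of `SU(2)`. -/
def diagSU (x : ℝ) : SU2 := ⟨_, diag_mem x⟩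

/-- The one-parameter subgroup of real rotations in `SU(2)`. -/
def rotSU (x : ℝ) : SU2 := ⟨_, rot_mem x⟩

theorem euler_eq (φ ϑ ψ : ℝ) :
    euler φ ϑ ψ = diagSU (φ / 2) * rotSU (ϑ / 2) * diagSU (ψ / 2) := rfl

theorem diagSU_zero : diagSU 0 = 1 := by
  apply Subtype.ext
  ext i j
  fin_cases i <;> fin_cases j <;> simp [diagSU]

theorem rotSU_zero : rotSU 0 = 1 := by
  apply Subtype.ext
  ext i j
  fin_cases i <;> fin_cases j <;> simp [rotSU]

/-! ### Signs, parity and the infinitesimal form of a representation -/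

theorem sgn_mul_self (s : ZMod 2) : sgn s * sgn s = 1 := by
  unfold sgn; split_ifs <;> norm_num

theorem zmod_two_cases (s : ZMod 2) : s = 0 ∨ s = 1 := by
  revert s; decide

theorem sgn_zero : sgn 0 = 1 := by simp [sgn]

theorem sgn_one : sgn 1 = -1 := by simp [sgn]

theorem sgn_add (s t : ZMod 2) : sgn (s + t) = sgn s * sgn t := by
  have h : (1 + 1 : ZMod 2) = 0 := by decide
  rcases zmod_two_cases s with rfl | rfl <;> rcases zmod_two_cases t with rfl | rfl <;>
    simp [sgn_zero, sgn_one, h]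

theorem sgn_injective : Function.Injective sgn := by
  intro s t h
  rcases zmod_two_cases s with rfl | rfl <;> rcases zmod_two_cases t with rfl | rfl <;>
    first | rfl | (exfalso; rw [sgn_zero, sgn_one] at h; norm_num at h)

/-- The parity operator. -/
def SuperMatrix.grading (R : SuperMatrix) : Matrix R.ι R.ι ℂ :=
  Matrix.diagonal fun i => sgn (R.parity i)

theorem SuperMatrix.grading_mul_self (R : SuperMatrix) : R.grading * R.grading = 1 := by
  rw [SuperMatrix.grading, Matrix.diagonal_mul_diagonal, ← Matrix.diagonal_one]
  simp only [sgn_mul_self]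

/-- The Lie superalgebra data behind a representation of `UOSp(1|2)`: the action `D` of `SU(2)`,
the odd generators `Vp`, `Vm`, and the weights `w` (twice the eigenvalues of `J₃`). -/
structure Realization (R : SuperMatrix) where
  /-- the action of `SU(2)` -/
  D : SU2 → Matrix R.ι R.ι ℂ
  /-- the odd raising operator -/
  Vp : Matrix R.ι R.ι ℂ
  /-- the odd lowering operator -/
  Vm : Matrix R.ι R.ι ℂ
  /-- the weights of the basis vectors -/
  w : R.ι → ℤ
  mat_eq : ∀ g, R.mat g = scaled (D g) 1 + scaled (D g * Vp) etaBar + scaled (D g * Vm) eta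
    + scaled ((1 / 2 : ℂ) • (D g * (Vp * Vm - Vm * Vp))) (etaBar * eta)
  D_even : ∀ g, D g * R.grading = R.grading * D g
  Vp_odd : Vp * R.grading = -(R.grading * Vp)
  Vm_odd : Vm * R.grading = -(R.grading * Vm)
  D_one : D 1 = 1
  anticomm : Vp * Vm + Vm * Vp = (-1 / 4 : ℂ) • Matrix.diagonal fun i => (w i : ℂ)
  shift_Vp : (Matrix.diagonal fun i => (w i : ℂ)) * Vp
    = Vp * (Matrix.diagonal fun i => (w i : ℂ)) + Vp
  shift_Vm : (Matrix.diagonal fun i => (w i : ℂ)) * Vm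
    = Vm * (Matrix.diagonal fun i => (w i : ℂ)) - Vm
  -- Adjointness is asked only of the squares: cross terms cancel there, so this relation passes to
  -- graded tensor products.
  adjoint : (Vp * Vp)ᴴ = -(Vm * Vm)
  deriv_diag : ∀ h s i k, HasDerivAt (fun s => D (h * diagSU s) i k)
    ((D (h * diagSU s) * ((-Complex.I) • Matrix.diagonal fun i => (w i : ℂ))) i k) s
  -- In the irreducible case V₊² = J₊/4 and V₋² = -J₋/4, so 4(V₊² + V₋²) is J₊ - J₋, the generator
  -- of the rotations.
  deriv_rot : ∀ h s i k, HasDerivAt (fun s => D (h * rotSU s) i k)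
    ((D (h * rotSU s) * ((4 : ℂ) • (Vp * Vp + Vm * Vm))) i k) s

/-! ### Graded tensor products -/

/-- The factor `s` on the odd coefficients of the left element is the sign created by the graded
tensor product. -/
theorem grassmann_mul (x0 x1 x2 x3 y0 y1 y2 y3 s : ℂ) :
    (x0 • (1 : Grassmann) + (s * x1) • etaBar + (s * x2) • eta + x3 • (etaBar * eta))
        * (y0 • 1 + y1 • etaBar + y2 • eta + y3 • (etaBar * eta))
      = (x0 * y0) • 1 + (s * x1 * y0 + x0 * y1) • etaBar + (s * x2 * y0 + x0 * y2) • eta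
        + (x3 * y0 + x0 * y3 + s * x1 * y2 - s * x2 * y1) • (etaBar * eta) := by
  have e1 : etaBar * (etaBar * eta) = 0 := by rw [← mul_assoc, etaBar_mul_self, zero_mul]
  have e2 : etaBar * eta * eta = 0 := by rw [mul_assoc, eta_mul_self, mul_zero]
  have e3 : eta * (etaBar * eta) = 0 := by
    rw [← mul_assoc, eta_mul_etaBar, neg_mul, e2, neg_zero]
  have e4 : etaBar * eta * etaBar = 0 := by
    rw [mul_assoc, eta_mul_etaBar, mul_neg, e1, neg_zero]
  have e5 : etaBar * eta * (etaBar * eta) = 0 := by rw [mul_assoc, e3, mul_zero]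
  simp only [mul_add, add_mul, smul_mul_smul_comm, mul_one, one_mul, e1, e2, e3, e4, e5,
    etaBar_mul_self, eta_mul_self, eta_mul_etaBar, smul_zero]
  module

namespace SuperMatrix

variable (R S : SuperMatrix)

/-- The odd operator `V ⊗ Γ + 1 ⊗ W` on a graded tensor product. -/
def oddSum (V : Matrix R.ι R.ι ℂ) (W : Matrix S.ι S.ι ℂ) :
    Matrix (R.ι × S.ι) (R.ι × S.ι) ℂ :=
  V ⊗ₖ S.grading + 1 ⊗ₖ W

theorem grading_tensor : (R.tensor S).grading = R.grading ⊗ₖ S.grading := by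
  rw [grading, grading, grading, Matrix.diagonal_kronecker_diagonal]
  congr 1
  ext i
  exact sgn_add _ _

variable {R S}

/-- Since Γ² = 1 and W anticommutes with Γ, the two cross terms have the same shape and opposite
signs. They cancel in squares and in anticommutators, which is why the osp(1|2) relations survive
tensoring. -/
theorem oddSum_mul {V V' : Matrix R.ι R.ι ℂ} {W W' : Matrix S.ι S.ι ℂ}
    (h : W * S.grading = -(S.grading * W)) :
    oddSum R S V W * oddSum R S V' W'
      = (V * V') ⊗ₖ 1 + V ⊗ₖ (S.grading * W') - V' ⊗ₖ (S.grading * W) + 1 ⊗ₖ (W * W') := by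
  simp only [oddSum, add_mul, mul_add, ← Matrix.mul_kronecker_mul, S.grading_mul_self, one_mul,
    mul_one, h]
  rw [show V' ⊗ₖ (-(S.grading * W)) = -(V' ⊗ₖ (S.grading * W)) by
    ext i j; simp [Matrix.kroneckerMap_apply]]
  abel

theorem oddSum_odd {V : Matrix R.ι R.ι ℂ} {W : Matrix S.ι S.ι ℂ}
    (hV : V * R.grading = -(R.grading * V)) (hW : W * S.grading = -(S.grading * W)) :
    oddSum R S V W * (R.grading ⊗ₖ S.grading)
      = -((R.grading ⊗ₖ S.grading) * oddSum R S V W) := by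
  simp only [oddSum, add_mul, mul_add, ← Matrix.mul_kronecker_mul, one_mul, mul_one, hV, hW]
  ext i j
  simp only [Matrix.add_apply, Matrix.neg_apply, Matrix.kroneckerMap_apply]
  ring

/-- An even matrix has nonzero entries only between indices of equal parity, where the exponent
vanishes. -/
theorem sgn_mul_of_even {A : Matrix R.ι R.ι ℂ} (h : A * R.grading = R.grading * A)
    (s : ZMod 2) (i k : R.ι) : sgn (s * (R.parity i + R.parity k)) * A i k = A i k := by
  have h1 := congrFun (congrFun h i) k
  rw [grading, Matrix.mul_diagonal, Matrix.diagonal_mul] at h1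
  by_cases hA : A i k = 0
  · rw [hA, mul_zero]
  · have h2 : sgn (R.parity k) = sgn (R.parity i) := by
      apply mul_left_cancel₀ hA
      rw [h1, mul_comm]
    rw [sgn_injective h2, CharTwo.add_self_eq_zero, mul_zero, sgn_zero, one_mul]

/-- An odd matrix has nonzero entries only between opposite parities, where the exponent reduces to
`s`. -/
theorem sgn_mul_of_odd {A : Matrix R.ι R.ι ℂ} (h : A * R.grading = -(R.grading * A))
    (s : ZMod 2) (i k : R.ι) : sgn (s * (R.parity i + R.parity k)) * A i k = sgn s * A i k := by
  have h1 := congrFun (congrFun h i) k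
  rw [Matrix.neg_apply, grading, Matrix.mul_diagonal, Matrix.diagonal_mul] at h1
  by_cases hA : A i k = 0
  · rw [hA, mul_zero, mul_zero]
  · have h2 : sgn (R.parity k) = -sgn (R.parity i) := by
      apply mul_left_cancel₀ hA
      rw [h1, mul_neg, mul_comm]
    have h3 : R.parity i + R.parity k = 1 := by
      apply sgn_injective
      rw [sgn_add, h2, mul_neg, sgn_mul_self, sgn_one]
    rw [h3, mul_one]

end SuperMatrix

open SuperMatrix

/-- The tensor sign affects only the odd coefficients of the first factor, where it becomes the
parity sign of the row index of the second factor. This is left multiplication by Γ, the source of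
the operators V ⊗ Γ + 1 ⊗ W. The four Grassmann coefficients are then compared. -/
theorem Realization.tensor_mat_apply {R S : SuperMatrix} (r : Realization R) (q : Realization S)
    (g : SU2) (i k : R.ι × S.ι) :
    sgn (S.parity i.2 * (R.parity i.1 + R.parity k.1)) • (R.mat g i.1 k.1 * S.mat g i.2 k.2)
      = (scaled (r.D g ⊗ₖ q.D g) 1
      + scaled ((r.D g ⊗ₖ q.D g) * oddSum R S r.Vp q.Vp) etaBar
      + scaled ((r.D g ⊗ₖ q.D g) * oddSum R S r.Vm q.Vm) eta
      + scaled ((1 / 2 : ℂ) • ((r.D g ⊗ₖ q.D g) * (oddSum R S r.Vp q.Vp * oddSum R S r.Vm q.Vm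
        - oddSum R S r.Vm q.Vm * oddSum R S r.Vp q.Vp))) (etaBar * eta)) i k := by
  have hodd : ∀ V : Matrix R.ι R.ι ℂ, V * R.grading = -(R.grading * V) →
      r.D g * V * R.grading = -(R.grading * (r.D g * V)) := by
    intro V hV
    rw [Matrix.mul_assoc, hV, Matrix.mul_neg, ← Matrix.mul_assoc, r.D_even, Matrix.mul_assoc]
  have heven : r.D g * (r.Vp * r.Vm - r.Vm * r.Vp) * R.grading
      = R.grading * (r.D g * (r.Vp * r.Vm - r.Vm * r.Vp)) := by
    rw [mul_assoc, sub_mul, mul_assoc, r.Vm_odd, mul_assoc, r.Vp_odd, mul_neg, mul_neg,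
      ← mul_assoc, r.Vp_odd, ← mul_assoc, r.Vm_odd, neg_mul, neg_mul, neg_neg, neg_neg,
      mul_assoc, mul_assoc, ← mul_sub, ← mul_assoc, r.D_even, mul_assoc]
  have hV : ∀ (V : Matrix R.ι R.ι ℂ) (W : Matrix S.ι S.ι ℂ),
      (r.D g ⊗ₖ q.D g) * oddSum R S V W
        = (r.D g * V) ⊗ₖ (S.grading * q.D g) + r.D g ⊗ₖ (q.D g * W) := by
    intro V W
    rw [oddSum, mul_add, ← Matrix.mul_kronecker_mul, ← Matrix.mul_kronecker_mul, mul_one, q.D_even]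
  have hC : (r.D g ⊗ₖ q.D g) * (oddSum R S r.Vp q.Vp * oddSum R S r.Vm q.Vm
        - oddSum R S r.Vm q.Vm * oddSum R S r.Vp q.Vp)
      = (r.D g * (r.Vp * r.Vm - r.Vm * r.Vp)) ⊗ₖ q.D g
        + r.D g ⊗ₖ (q.D g * (q.Vp * q.Vm - q.Vm * q.Vp))
        + (2 : ℂ) • ((r.D g * r.Vp) ⊗ₖ (S.grading * (q.D g * q.Vm)))
        - (2 : ℂ) • ((r.D g * r.Vm) ⊗ₖ (S.grading * (q.D g * q.Vp))) := by
    rw [oddSum_mul q.Vp_odd, oddSum_mul q.Vm_odd, ← mul_assoc, ← mul_assoc, ← q.D_even, mul_assoc,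
      mul_assoc]
    simp only [mul_sub, mul_add, ← Matrix.mul_kronecker_mul, mul_one]
    ext i k
    simp only [Matrix.sub_apply, Matrix.add_apply, Matrix.smul_apply, Matrix.kroneckerMap_apply,
      smul_eq_mul]
    ring
  have h1 : sgn (S.parity i.2 * (R.parity i.1 + R.parity k.1)) • R.mat g i.1 k.1
      = (r.D g i.1 k.1) • (1 : Grassmann)
        + (sgn (S.parity i.2) * (r.D g * r.Vp) i.1 k.1) • etaBar
        + (sgn (S.parity i.2) * (r.D g * r.Vm) i.1 k.1) • eta
        + (1 / 2 * (r.D g * (r.Vp * r.Vm - r.Vm * r.Vp)) i.1 k.1) • (etaBar * eta) := by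
    rw [r.mat_eq]
    simp only [Matrix.add_apply, scaled_apply, smul_add, smul_smul, Matrix.smul_apply, smul_eq_mul]
    rw [sgn_mul_of_even (r.D_even g), sgn_mul_of_odd (hodd _ r.Vp_odd),
      sgn_mul_of_odd (hodd _ r.Vm_odd), mul_left_comm, sgn_mul_of_even heven]
  rw [← smul_mul_assoc, h1, q.mat_eq, hV, hV, hC]
  simp only [Matrix.add_apply, scaled_apply, Matrix.smul_apply, smul_eq_mul]
  rw [grassmann_mul]
  simp only [Matrix.sub_apply, Matrix.add_apply, Matrix.smul_apply, Matrix.kroneckerMap_apply,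
    smul_eq_mul, SuperMatrix.grading, Matrix.diagonal_mul]
  congr 1
  · congr 1
    · congr 2
      ring
    · congr 1
      ring
  · congr 1
    ring

theorem hasDerivAt_kronecker {m n : Type*} [Fintype m] [Fintype n] [DecidableEq m]
    [DecidableEq n] {A : ℝ → Matrix m m ℂ} {B : ℝ → Matrix n n ℂ} {K : Matrix m m ℂ}
    {L : Matrix n n ℂ} {s : ℝ}
    (hA : ∀ i k, HasDerivAt (fun s => A s i k) ((A s * K) i k) s)
    (hB : ∀ i k, HasDerivAt (fun s => B s i k) ((B s * L) i k) s) (i k : m × n) :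
    HasDerivAt (fun s => (A s ⊗ₖ B s) i k) (((A s ⊗ₖ B s) * (K ⊗ₖ (1 : Matrix n n ℂ) + (1 : Matrix m m ℂ) ⊗ₖ L)) i k) s := by
  rw [mul_add, ← Matrix.mul_kronecker_mul, ← Matrix.mul_kronecker_mul, mul_one, mul_one]
  exact (hA i.1 k.1).mul (hB i.2 k.2)

theorem diagonal_weight_tensor {m n : Type*} [DecidableEq m] [DecidableEq n]
    (v : m → ℤ) (w : n → ℤ) :
    (Matrix.diagonal fun i : m × n => ((v i.1 + w i.2 : ℤ) : ℂ))
      = (Matrix.diagonal fun i => (v i : ℂ)) ⊗ₖ 1 + 1 ⊗ₖ (Matrix.diagonal fun i => (w i : ℂ)) := by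
  rw [← Matrix.diagonal_one, ← Matrix.diagonal_one, Matrix.diagonal_kronecker_diagonal,
    Matrix.diagonal_kronecker_diagonal, Matrix.diagonal_add]
  congr 1
  ext i
  push_cast
  ring

/-- The graded tensor product of two realizations. -/
def Realization.tensor {R S : SuperMatrix} (r : Realization R) (q : Realization S) :
    Realization (R.tensor S) where
  D g := r.D g ⊗ₖ q.D g
  Vp := oddSum R S r.Vp q.Vp
  Vm := oddSum R S r.Vm q.Vm
  w i := r.w i.1 + q.w i.2
  mat_eq g := Matrix.ext (r.tensor_mat_apply q g)
  D_even g := by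
    have h : (r.D g ⊗ₖ q.D g) * (R.grading ⊗ₖ S.grading)
        = (R.grading ⊗ₖ S.grading) * (r.D g ⊗ₖ q.D g) := by
      rw [← Matrix.mul_kronecker_mul, ← Matrix.mul_kronecker_mul, r.D_even, q.D_even]
    rw [grading_tensor]
    exact h
  Vp_odd := by rw [grading_tensor]; exact oddSum_odd r.Vp_odd q.Vp_odd
  Vm_odd := by rw [grading_tensor]; exact oddSum_odd r.Vm_odd q.Vm_odd
  D_one := by
    show r.D 1 ⊗ₖ q.D 1 = 1
    rw [r.D_one, q.D_one, Matrix.one_kronecker_one]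
  anticomm := by
    show oddSum R S r.Vp q.Vp * oddSum R S r.Vm q.Vm + oddSum R S r.Vm q.Vm * oddSum R S r.Vp q.Vp
      = (-1 / 4 : ℂ) • Matrix.diagonal fun i : R.ι × S.ι => ((r.w i.1 + q.w i.2 : ℤ) : ℂ)
    rw [diagonal_weight_tensor, smul_add, ← Matrix.smul_kronecker, ← Matrix.kronecker_smul,
      ← r.anticomm, ← q.anticomm, oddSum_mul q.Vp_odd, oddSum_mul q.Vm_odd, Matrix.add_kronecker,
      Matrix.kronecker_add]
    abel
  shift_Vp := by
    show (Matrix.diagonal fun i : R.ι × S.ι => ((r.w i.1 + q.w i.2 : ℤ) : ℂ))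
        * oddSum R S r.Vp q.Vp = oddSum R S r.Vp q.Vp
        * (Matrix.diagonal fun i : R.ι × S.ι => ((r.w i.1 + q.w i.2 : ℤ) : ℂ))
        + oddSum R S r.Vp q.Vp
    have hc : (Matrix.diagonal fun i => (q.w i : ℂ)) * S.grading
        = S.grading * Matrix.diagonal fun i => (q.w i : ℂ) := by
      rw [SuperMatrix.grading, Matrix.diagonal_mul_diagonal, Matrix.diagonal_mul_diagonal]
      simp only [mul_comm]
    rw [diagonal_weight_tensor, oddSum]
    simp only [mul_add, add_mul, ← Matrix.mul_kronecker_mul, one_mul, mul_one, r.shift_Vp,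
      q.shift_Vp, hc, Matrix.add_kronecker, Matrix.kronecker_add]
    abel
  shift_Vm := by
    show (Matrix.diagonal fun i : R.ι × S.ι => ((r.w i.1 + q.w i.2 : ℤ) : ℂ))
        * oddSum R S r.Vm q.Vm = oddSum R S r.Vm q.Vm
        * (Matrix.diagonal fun i : R.ι × S.ι => ((r.w i.1 + q.w i.2 : ℤ) : ℂ))
        - oddSum R S r.Vm q.Vm
    have hc : (Matrix.diagonal fun i => (q.w i : ℂ)) * S.grading
        = S.grading * Matrix.diagonal fun i => (q.w i : ℂ) := by
      rw [SuperMatrix.grading, Matrix.diagonal_mul_diagonal, Matrix.diagonal_mul_diagonal]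
      simp only [mul_comm]
    rw [diagonal_weight_tensor, oddSum]
    simp only [mul_add, add_mul, ← Matrix.mul_kronecker_mul, one_mul, mul_one, r.shift_Vm,
      q.shift_Vm, hc]
    ext i k
    simp only [Matrix.add_apply, Matrix.sub_apply, Matrix.kroneckerMap_apply]
    ring
  adjoint := by
    show (oddSum R S r.Vp q.Vp * oddSum R S r.Vp q.Vp)ᴴ
      = -(oddSum R S r.Vm q.Vm * oddSum R S r.Vm q.Vm)
    rw [oddSum_mul q.Vp_odd, oddSum_mul q.Vm_odd, add_sub_cancel_right, add_sub_cancel_right,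
      Matrix.conjTranspose_add, Matrix.conjTranspose_kronecker, Matrix.conjTranspose_kronecker,
      r.adjoint, q.adjoint, Matrix.conjTranspose_one, Matrix.conjTranspose_one]
    ext i k
    simp only [Matrix.add_apply, Matrix.neg_apply, Matrix.kroneckerMap_apply]
    ring
  deriv_diag h s i k := by
    show HasDerivAt (fun s => (r.D (h * diagSU s) ⊗ₖ q.D (h * diagSU s)) i k)
      ((r.D (h * diagSU s) ⊗ₖ q.D (h * diagSU s) *
      ((-Complex.I) • Matrix.diagonal fun i : R.ι × S.ι => ((r.w i.1 + q.w i.2 : ℤ) : ℂ))) i k) s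
    rw [diagonal_weight_tensor, smul_add, ← Matrix.smul_kronecker, ← Matrix.kronecker_smul]
    exact hasDerivAt_kronecker (A := fun s => r.D (h * diagSU s))
      (B := fun s => q.D (h * diagSU s)) (r.deriv_diag h s) (q.deriv_diag h s) i k
  deriv_rot h s i k := by
    show HasDerivAt (fun s => (r.D (h * rotSU s) ⊗ₖ q.D (h * rotSU s)) i k)
      ((r.D (h * rotSU s) ⊗ₖ q.D (h * rotSU s) *
      ((4 : ℂ) • (oddSum R S r.Vp q.Vp * oddSum R S r.Vp q.Vp
        + oddSum R S r.Vm q.Vm * oddSum R S r.Vm q.Vm))) i k) s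
    have e : (4 : ℂ) • (oddSum R S r.Vp q.Vp * oddSum R S r.Vp q.Vp
        + oddSum R S r.Vm q.Vm * oddSum R S r.Vm q.Vm)
        = ((4 : ℂ) • (r.Vp * r.Vp + r.Vm * r.Vm)) ⊗ₖ 1
          + 1 ⊗ₖ ((4 : ℂ) • (q.Vp * q.Vp + q.Vm * q.Vm)) := by
      rw [oddSum_mul q.Vp_odd, oddSum_mul q.Vm_odd, add_sub_cancel_right, add_sub_cancel_right,
        Matrix.smul_kronecker, Matrix.kronecker_smul, Matrix.add_kronecker, Matrix.kronecker_add,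
        ← smul_add]
      congr 1
      abel
    rw [e]
    exact hasDerivAt_kronecker (A := fun s => r.D (h * rotSU s))
      (B := fun s => q.D (h * rotSU s)) (r.deriv_rot h s) (q.deriv_rot h s) i k

/-! ### Derivatives of the spin representations -/

open Polynomial in
/-- Coefficientwise differentiability of a curve of polynomials. -/
def HasCoeffDeriv (f : ℝ → ℂ[X]) (f' : ℂ[X]) (s : ℝ) : Prop :=
  ∀ i, HasDerivAt (fun s => (f s).coeff i) (f'.coeff i) s

open Polynomial in
theorem HasCoeffDeriv.mul {f g : ℝ → ℂ[X]} {f' g' : ℂ[X]} {s : ℝ} (hf : HasCoeffDeriv f f' s)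
    (hg : HasCoeffDeriv g g' s) :
    HasCoeffDeriv (fun s => f s * g s) (f' * g s + f s * g') s := by
  intro i
  simp only [Polynomial.coeff_mul, Polynomial.coeff_add, ← Finset.sum_add_distrib]
  exact HasDerivAt.fun_sum fun x _ => (hf x.1).mul (hg x.2)

open Polynomial in
theorem HasCoeffDeriv.pow {f : ℝ → ℂ[X]} {f' : ℂ[X]} {s : ℝ} (hf : HasCoeffDeriv f f' s) (k : ℕ) :
    HasCoeffDeriv (fun s => f s ^ k) ((k : ℂ[X]) * f s ^ (k - 1) * f') s := by
  induction k with
  | zero =>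
    intro i
    simpa using hasDerivAt_const s _
  | succ k ih =>
    have h := ih.mul hf
    simp only [← pow_succ] at h
    convert h using 1
    rcases k with _ | k
    · simp
    · simp only [Nat.add_sub_cancel]
      push_cast
      ring

/-- The image of the Lie algebra element `K` in the representation of dimension `N`. -/
def spinGen (N : ℕ) (K : Matrix (Fin 2) (Fin 2) ℂ) : Matrix (Fin N) (Fin N) ℂ := fun m k =>
  (if (m : ℕ) = k then ((k : ℕ) : ℂ) * K 0 0 + ((N - 1 - k : ℕ) : ℂ) * K 1 1 else 0)
  + (if (m : ℕ) + 1 = k then K 1 0 * (Real.sqrt ((k * (N - k) : ℕ)) : ℂ) else 0)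
  + (if (m : ℕ) = k + 1 then K 0 1 * (Real.sqrt (((k + 1) * (N - 1 - k) : ℕ)) : ℂ) else 0)

theorem sum_fin_ite {N : ℕ} (t : ℕ) (f : Fin N → ℂ) :
    ∑ m : Fin N, (if (m : ℕ) = t then f m else 0) = if h : t < N then f ⟨t, h⟩ else 0 := by
  split_ifs with h
  · rw [Finset.sum_eq_single ⟨t, h⟩]
    · simp
    · intro b _ hb
      rw [if_neg fun hbt => hb (Fin.ext hbt)]
    · simp
  · exact Finset.sum_eq_zero fun m _ => if_neg fun hm => h (by rw [← hm]; exact m.2)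

theorem factorial_ratio (j l : ℕ) :
    ((j : ℝ) + 1) * Real.sqrt (j.factorial * (l + 1).factorial)
      = Real.sqrt (((j + 1) * (l + 1) : ℕ)) * Real.sqrt ((j + 1).factorial * l.factorial) := by
  rw [← Real.sqrt_mul (by positivity)]
  nth_rewrite 1 [← Real.sqrt_sq (by positivity : (0 : ℝ) ≤ (j : ℝ) + 1)]
  rw [← Real.sqrt_mul (by positivity)]
  congr 1
  rw [Nat.factorial_succ, Nat.factorial_succ]
  push_cast
  ring

/-- Ratio of the norms of neighbouring monomials: it converts the exponent produced by
differentiation into the ladder coefficient √((j+1)(l+1)). -/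
theorem factorial_ratio_div (j l : ℕ) :
    ((j : ℝ) + 1) / Real.sqrt ((j + 1).factorial * l.factorial)
      = Real.sqrt (((j + 1) * (l + 1) : ℕ)) / Real.sqrt (j.factorial * (l + 1).factorial) := by
  rw [div_eq_div_iff, factorial_ratio]
  all_goals positivity

theorem wignerD_apply (N : ℕ) (g : SU2) (k' k : Fin N) :
    wignerD N g k' k = ((Real.sqrt ((k' : ℕ).factorial * (N - 1 - (k' : ℕ)).factorial)
        / Real.sqrt ((k : ℕ).factorial * (N - 1 - (k : ℕ)).factorial) : ℝ) : ℂ) *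
      ((Polynomial.C (g.1 0 0) * Polynomial.X + Polynomial.C (g.1 1 0)) ^ (k : ℕ)
        * (Polynomial.C (g.1 0 1) * Polynomial.X + Polynomial.C (g.1 1 1))
          ^ (N - 1 - (k : ℕ))).coeff k' := rfl

theorem wignerD_one (N : ℕ) : wignerD N 1 = 1 := by
  ext k' k
  rw [wignerD_apply]
  simp only [OneMemClass.coe_one, Matrix.one_apply_eq, ne_eq, zero_ne_one, one_ne_zero,
    not_false_eq_true, Matrix.one_apply_ne, map_one, map_zero, one_mul, add_zero, zero_mul,
    zero_add, one_pow, mul_one, Polynomial.coeff_X_pow, Matrix.one_apply, Fin.ext_iff]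
  split_ifs with h
  · rw [h, div_self]
    · simp
    · positivity
  · simp

open Polynomial in
-- The right side is the product-rule derivative of L₁^k L₂^(N-1-k) in the direction gK. The
-- derivatives of L₁ and L₂ are combinations of L₁ and L₂ with the entries of K as coefficients, so
-- only the exponents k and k ± 1 occur, matching the three diagonals of `spinGen`.
theorem wignerD_mul_spinGen (N : ℕ) (g : SU2) (K : Matrix (Fin 2) (Fin 2) ℂ) (k' k : Fin N) :
    (wignerD N g * spinGen N K) k' k
      = ((Real.sqrt ((k' : ℕ).factorial * (N - 1 - (k' : ℕ)).factorial)
        / Real.sqrt ((k : ℕ).factorial * (N - 1 - (k : ℕ)).factorial) : ℝ) : ℂ) *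
      ((((k : ℕ) : ℂ[X]) * (C (g.1 0 0) * X + C (g.1 1 0)) ^ ((k : ℕ) - 1)
          * (C ((g.1 * K) 0 0) * X + C ((g.1 * K) 1 0)))
          * (C (g.1 0 1) * X + C (g.1 1 1)) ^ (N - 1 - (k : ℕ))
        + (C (g.1 0 0) * X + C (g.1 1 0)) ^ (k : ℕ)
          * (((N - 1 - (k : ℕ) : ℕ) : ℂ[X]) * (C (g.1 0 1) * X + C (g.1 1 1)) ^ (N - 1 - (k : ℕ) - 1)
          * (C ((g.1 * K) 0 1) * X + C ((g.1 * K) 1 1)))).coeff k' := by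
  set L1 : ℂ[X] := C (g.1 0 0) * X + C (g.1 1 0) with hL1
  set L2 : ℂ[X] := C (g.1 0 1) * X + C (g.1 1 1) with hL2
  have e1 : C ((g.1 * K) 0 0) * X + C ((g.1 * K) 1 0) = C (K 0 0) * L1 + C (K 1 0) * L2 := by
    simp only [Matrix.mul_apply, Fin.sum_univ_two, hL1, hL2, map_add, map_mul]
    ring
  have e2 : C ((g.1 * K) 0 1) * X + C ((g.1 * K) 1 1) = C (K 0 1) * L1 + C (K 1 1) * L2 := by
    simp only [Matrix.mul_apply, Fin.sum_univ_two, hL1, hL2, map_add, map_mul]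
    ring
  rw [e1, e2, Matrix.mul_apply]
  simp only [spinGen, mul_add, mul_ite, mul_zero, Finset.sum_add_distrib, wignerD_apply,
    ← hL1, ← hL2]
  obtain ⟨k, hk⟩ := k
  simp only
  have hk0 : ∃ l, N = k + l + 1 := ⟨N - k - 1, by omega⟩
  obtain ⟨l, rfl⟩ := hk0
  have hl : k + l + 1 - 1 - k = l := by omega
  have s1 := sum_fin_ite (N := k + l + 1) k
  have s3 := sum_fin_ite (N := k + l + 1) (k + 1)
  simp only [hl]
  rw [s1 _, s3 _, dif_pos hk]
  simp only [hl]
  set ν := Real.sqrt ((k' : ℕ).factorial * (k + l + 1 - 1 - (k' : ℕ)).factorial)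
  have t2 : ∑ m : Fin (k + l + 1), (if (m : ℕ) + 1 = k then
      ((ν / Real.sqrt ((m : ℕ).factorial * (k + l + 1 - 1 - (m : ℕ)).factorial) : ℝ) : ℂ)
        * (L1 ^ (m : ℕ) * L2 ^ (k + l + 1 - 1 - (m : ℕ))).coeff k'
        * (K 1 0 * (Real.sqrt ((k * (k + l + 1 - k) : ℕ)) : ℂ)) else 0)
      = ((ν / Real.sqrt (k.factorial * l.factorial) : ℝ) : ℂ)
        * ((k : ℂ) * K 1 0 * (L1 ^ (k - 1) * L2 ^ (l + 1)).coeff k') := by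
    rcases k with _ | j
    · simp
    · simp only [Nat.add_right_cancel_iff]
      rw [sum_fin_ite, dif_pos (by omega)]
      have h1 : j + 1 + l + 1 - 1 - j = l + 1 := by omega
      have h2 : j + 1 + l + 1 - (j + 1) = l + 1 := by omega
      simp only [h1, h2]
      rw [Nat.add_sub_cancel]
      have h3 := congrArg (fun x : ℝ => ((ν * x : ℝ) : ℂ)) (factorial_ratio_div j l)
      simp only [mul_div_assoc'] at h3
      push_cast at h3 ⊢
      linear_combination (-(K 1 0) * (L1 ^ j * L2 ^ (l + 1)).coeff k') * h3
  have t3 : (if h : k + 1 < k + l + 1 then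
      ((ν / Real.sqrt ((k + 1).factorial * (k + l + 1 - 1 - (k + 1)).factorial) : ℝ) : ℂ)
        * (L1 ^ (k + 1) * L2 ^ (k + l + 1 - 1 - (k + 1))).coeff k'
        * (K 0 1 * (Real.sqrt (((k + 1) * l : ℕ)) : ℂ)) else 0)
      = ((ν / Real.sqrt (k.factorial * l.factorial) : ℝ) : ℂ)
        * ((l : ℂ) * K 0 1 * (L1 ^ (k + 1) * L2 ^ (l - 1)).coeff k') := by
    rcases l with _ | j
    · simp
    · rw [dif_pos (by omega)]
      have h1 : k + (j + 1) + 1 - 1 - (k + 1) = j := by omega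
      simp only [h1]
      rw [Nat.add_sub_cancel]
      have h3 := congrArg (fun x : ℝ => ((ν * x : ℝ) : ℂ)) (factorial_ratio_div j k)
      simp only [mul_div_assoc'] at h3
      rw [mul_comm ((j + 1).factorial : ℝ), mul_comm (j.factorial : ℝ), mul_comm (j + 1)] at h3
      push_cast at h3 ⊢
      linear_combination (-(K 0 1) * (L1 ^ (k + 1) * L2 ^ j).coeff k') * h3
  rw [t2, t3]
  have hp : (k : ℂ[X]) * L1 ^ (k - 1) * (C (K 0 0) * L1 + C (K 1 0) * L2) * L2 ^ l
      + L1 ^ k * ((l : ℂ[X]) * L2 ^ (l - 1) * (C (K 0 1) * L1 + C (K 1 1) * L2))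
      = C ((k : ℂ) * K 0 0 + (l : ℂ) * K 1 1) * (L1 ^ k * L2 ^ l)
        + C ((k : ℂ) * K 1 0) * (L1 ^ (k - 1) * L2 ^ (l + 1))
        + C ((l : ℂ) * K 0 1) * (L1 ^ (k + 1) * L2 ^ (l - 1)) := by
    simp only [map_add, map_mul, map_natCast]
    -- The case split removes the truncated exponents k - 1 and l - 1; at zero the factor k or l
    -- kills the term.
    rcases k with _ | k <;> rcases l with _ | l <;>
      (try simp only [Nat.add_sub_cancel]) <;> push_cast <;> ring
  simp only [← mul_add]
  rw [hp, coeff_add, coeff_add, coeff_C_mul, coeff_C_mul, coeff_C_mul]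
  ring

theorem hasDerivAt_wignerD (N : ℕ) {γ : ℝ → SU2} {K : Matrix (Fin 2) (Fin 2) ℂ} {s : ℝ}
    (hγ : ∀ i j, HasDerivAt (fun s => (γ s).1 i j) (((γ s).1 * K) i j) s) (i k : Fin N) :
    HasDerivAt (fun s => wignerD N (γ s) i k) ((wignerD N (γ s) * spinGen N K) i k) s := by
  have hlin : ∀ j, HasCoeffDeriv
      (fun s => Polynomial.C ((γ s).1 0 j) * Polynomial.X + Polynomial.C ((γ s).1 1 j))
      (Polynomial.C (((γ s).1 * K) 0 j) * Polynomial.X + Polynomial.C (((γ s).1 * K) 1 j)) s := by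
    intro j i
    simp only [Polynomial.coeff_add, Polynomial.coeff_C_mul, Polynomial.coeff_C,
      Polynomial.coeff_X]
    refine ((hγ 0 j).mul_const _).add ?_
    split_ifs
    · exact hγ 1 j
    · exact hasDerivAt_const _ _
  rw [wignerD_mul_spinGen]
  simp only [wignerD_apply]
  exact ((((hlin 0).pow k).mul ((hlin 1).pow (N - 1 - k))) i).const_mul _

theorem hasDerivAt_mul_diagSU (h : SU2) (s : ℝ) (i j : Fin 2) :
    HasDerivAt (fun s => (h * diagSU s).1 i j)
      (((h * diagSU s).1 * !![-Complex.I, 0; 0, Complex.I]) i j) s := by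
  have h1 : HasDerivAt (fun s : ℝ => Complex.exp (-(s : ℂ) * Complex.I))
      (Complex.exp (-(s : ℂ) * Complex.I) * -Complex.I) s := by
    have := ((hasDerivAt_id s).ofReal_comp.neg.mul_const Complex.I).cexp
    simpa using this
  have h2 : HasDerivAt (fun s : ℝ => Complex.exp ((s : ℂ) * Complex.I))
      (Complex.exp ((s : ℂ) * Complex.I) * Complex.I) s := by
    have := ((hasDerivAt_id s).ofReal_comp.mul_const Complex.I).cexp
    simpa using this
  simp only [Submonoid.coe_mul, diagSU, Matrix.mul_apply, Fin.sum_univ_two]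
  fin_cases j
  · simpa [mul_assoc] using h1.const_mul (h.1 i 0)
  · simpa [mul_assoc] using h2.const_mul (h.1 i 1)

theorem hasDerivAt_mul_rotSU (h : SU2) (s : ℝ) (i j : Fin 2) :
    HasDerivAt (fun s => (h * rotSU s).1 i j)
      (((h * rotSU s).1 * (!![0, 1; -1, 0] : Matrix (Fin 2) (Fin 2) ℂ)) i j) s := by
  have h1 : HasDerivAt (fun s : ℝ => (Real.cos s : ℂ)) (-(Real.sin s : ℂ)) s := by
    simpa using (Real.hasDerivAt_cos s).ofReal_comp
  have h2 : HasDerivAt (fun s : ℝ => (Real.sin s : ℂ)) (Real.cos s : ℂ) s :=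
    (Real.hasDerivAt_sin s).ofReal_comp
  simp only [Submonoid.coe_mul, rotSU, Matrix.mul_apply, Fin.sum_univ_two]
  fin_cases j
  · convert! (h1.const_mul (h.1 i 0)).add (h2.neg.const_mul (h.1 i 1)) using 1
    simp
    ring
  · convert! (h2.const_mul (h.1 i 0)).add (h1.const_mul (h.1 i 1)) using 1
    simp

/-! ### The irreducible representations -/

/-- The odd-to-even block of the raising operator. -/
def raiseEven (a : ℕ) : Matrix (Fin (a + 1)) (Fin a) ℂ := fun k r =>
  if (k : ℕ) = r + 1 then -(1 / 2) * (Real.sqrt ((r : ℕ) + 1) : ℂ) else 0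

/-- The even-to-odd block of the raising operator. -/
def raiseOdd (a : ℕ) : Matrix (Fin a) (Fin (a + 1)) ℂ := fun r k =>
  if (k : ℕ) = r then -(1 / 2) * (Real.sqrt ((a : ℝ) - (k : ℕ)) : ℂ) else 0

theorem Vplus_eq (a : ℕ) : Vplus a = fromBlocks 0 (raiseEven a) (raiseOdd a) 0 := by
  ext (i | i) (k | k) <;> rfl

/-- Up to the sign of one block, V₋ is the adjoint of V₊. That sign is responsible for (V₊²)* =
-V₋². -/
theorem Vminus_eq (a : ℕ) : Vminus a = fromBlocks 0 (raiseOdd a)ᴴ (-(raiseEven a)ᴴ) 0 := by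
  ext (i | i) (k | k)
  · rfl
  · simp only [Vminus, fromBlocks_apply₁₂, conjTranspose_apply, raiseOdd]
    split_ifs with h
    · simp [h]
    · simp
  · simp only [Vminus, fromBlocks_apply₂₁, conjTranspose_apply, raiseEven, Matrix.neg_apply]
    split_ifs with h
    · simp [h]
    · simp
  · rfl

theorem half_sqrt_mul_self {x : ℝ} (hx : 0 ≤ x) :
    (-(1 / 2) * (Real.sqrt x : ℂ)) * star (-(1 / 2) * (Real.sqrt x : ℂ)) = 1 / 4 * (x : ℂ) := by
  have h : (Real.sqrt x : ℂ) * (Real.sqrt x : ℂ) = x := by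
    rw [← Complex.ofReal_mul, Real.mul_self_sqrt hx]
  simp only [star_mul', RCLike.star_def, map_neg, map_div₀, map_one, Complex.conj_ofReal,
    map_ofNat]
  linear_combination (1 / 4) * h

theorem raiseEven_mul_conjTranspose (a : ℕ) :
    raiseEven a * (raiseEven a)ᴴ = diagonal fun k : Fin (a + 1) => 1 / 4 * ((k : ℕ) : ℂ) := by
  ext k k'
  rw [Matrix.mul_apply, Matrix.diagonal_apply]
  obtain ⟨k, hk⟩ := k
  rcases k with _ | k
  · simp [raiseEven]
  · rw [Finset.sum_eq_single ⟨k, by omega⟩]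
    · simp only [raiseEven, conjTranspose_apply, if_true, Fin.ext_iff]
      by_cases h : (k' : ℕ) = k + 1
      · rw [if_pos h, if_pos h.symm, half_sqrt_mul_self (by positivity)]
        push_cast
        ring
      · rw [if_neg h, if_neg (Ne.symm h), star_zero, mul_zero]
    · intro r _ hr
      simp only [raiseEven]
      rw [if_neg, zero_mul]
      intro h
      apply hr
      ext
      simp only at h ⊢
      omega
    · simp

theorem conjTranspose_mul_raiseEven (a : ℕ) :
    (raiseEven a)ᴴ * raiseEven a = diagonal fun r : Fin a => 1 / 4 * (((r : ℕ) : ℂ) + 1) := by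
  ext r r'
  rw [Matrix.mul_apply, Matrix.diagonal_apply, Finset.sum_eq_single r.succ]
  · simp only [raiseEven, conjTranspose_apply, Fin.val_succ, if_true, Fin.ext_iff,
      add_left_inj]
    split_ifs with h
    · rw [← h, mul_comm, half_sqrt_mul_self (by positivity)]
      push_cast
      ring
    · rw [mul_zero]
  · intro k _ hk
    simp only [raiseEven, conjTranspose_apply]
    rw [if_neg (show ¬ (k : ℕ) = r + 1 from fun h => hk (Fin.ext h)), star_zero, zero_mul]
  · simp

theorem raiseOdd_mul_conjTranspose (a : ℕ) :
    raiseOdd a * (raiseOdd a)ᴴ = diagonal fun r : Fin a => 1 / 4 * ((a : ℂ) - ((r : ℕ) : ℂ)) := by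
  ext r r'
  rw [Matrix.mul_apply, Matrix.diagonal_apply, Finset.sum_eq_single r.castSucc]
  · simp only [raiseOdd, conjTranspose_apply, Fin.val_castSucc, if_true, Fin.ext_iff]
    have hr : (0 : ℝ) ≤ (a : ℝ) - (r : ℕ) := by
      have : ((r : ℕ) : ℝ) ≤ a := by exact_mod_cast r.2.le
      linarith
    split_ifs with h
    · rw [half_sqrt_mul_self hr]
      push_cast
      ring
    · rw [star_zero, mul_zero]
  · intro k _ hk
    simp only [raiseOdd]
    rw [if_neg (show ¬ (k : ℕ) = r from fun h => hk (Fin.ext h)), zero_mul]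
  · simp

theorem conjTranspose_mul_raiseOdd (a : ℕ) :
    (raiseOdd a)ᴴ * raiseOdd a = diagonal fun k : Fin (a + 1) => 1 / 4 * ((a : ℂ) - ((k : ℕ) : ℂ)) := by
  ext k k'
  rw [Matrix.mul_apply, Matrix.diagonal_apply]
  by_cases hk : (k : ℕ) < a
  · rw [Finset.sum_eq_single ⟨k, hk⟩]
    · simp only [raiseOdd, conjTranspose_apply, if_true, Fin.ext_iff]
      have hr : (0 : ℝ) ≤ (a : ℝ) - (k : ℕ) := by
        have : ((k : ℕ) : ℝ) ≤ a := by exact_mod_cast hk.le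
        linarith
      by_cases h : (k' : ℕ) = k
      · rw [if_pos h, if_pos h.symm, h, mul_comm, half_sqrt_mul_self hr]
        push_cast
        ring
      · rw [if_neg h, if_neg (Ne.symm h), mul_zero]
    · intro r _ hr
      simp only [raiseOdd, conjTranspose_apply]
      rw [if_neg fun h => hr (Fin.ext h.symm), star_zero, zero_mul]
    · simp
  -- The top vector k = a is killed by the even-to-odd block, in agreement with a - k = 0.
  · have hka : (k : ℕ) = a := by have := k.2; omega
    rw [Finset.sum_eq_zero]
    · simp [hka]
    · intro r _
      simp only [raiseOdd, conjTranspose_apply]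
      rw [if_neg, star_zero, zero_mul]
      have := r.2
      omega

/-- The weights of `π_j`. -/
def irrepWeight (a : ℕ) : Idx a → ℤ :=
  Sum.elim (fun k => 2 * (k : ℕ) - a) fun r => 2 * (r : ℕ) + 1 - a

theorem diagonal_irrepWeight (a : ℕ) : (diagonal fun i => (irrepWeight a i : ℂ))
    = fromBlocks (diagonal fun k : Fin (a + 1) => 2 * ((k : ℕ) : ℂ) - a) 0 0
        (diagonal fun r : Fin a => 2 * ((r : ℕ) : ℂ) + 1 - a) := by
  rw [fromBlocks_diagonal]
  congr 1
  ext (i | i) <;> simp [irrepWeight]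

theorem Vplus_mul_Vminus (a : ℕ) : Vplus a * Vminus a
    = fromBlocks (diagonal fun k : Fin (a + 1) => -(1 / 4 * ((k : ℕ) : ℂ))) 0 0
        (diagonal fun r : Fin a => 1 / 4 * ((a : ℂ) - ((r : ℕ) : ℂ))) := by
  rw [Vplus_eq, Vminus_eq, fromBlocks_multiply]
  congr 1 <;> simp [raiseEven_mul_conjTranspose, raiseOdd_mul_conjTranspose]

theorem Vminus_mul_Vplus (a : ℕ) : Vminus a * Vplus a
    = fromBlocks (diagonal fun k : Fin (a + 1) => 1 / 4 * ((a : ℂ) - ((k : ℕ) : ℂ))) 0 0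
        (diagonal fun r : Fin a => -(1 / 4 * (((r : ℕ) : ℂ) + 1))) := by
  rw [Vplus_eq, Vminus_eq, fromBlocks_multiply]
  congr 1 <;> simp [conjTranspose_mul_raiseEven, conjTranspose_mul_raiseOdd]

/-- The commutator is a scalar on each parity block, so the η̄η part of the super character is a
combination of two `SU(2)` characters. -/
theorem Vplus_commutator (a : ℕ) : Vplus a * Vminus a - Vminus a * Vplus a
    = fromBlocks (diagonal fun _ : Fin (a + 1) => -(a : ℂ) / 4) 0 0
        (diagonal fun _ : Fin a => ((a : ℂ) + 1) / 4) := by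
  rw [Vplus_mul_Vminus, Vminus_mul_Vplus, fromBlocks_diagonal, fromBlocks_diagonal,
    fromBlocks_diagonal, diagonal_sub]
  congr 1
  ext (i | i) <;> simp <;> ring

/-- On the even block V₊² is J₊/4. The form `a + 1 - 1 - k` fits `spinGen_rot` at N = a + 1. -/
theorem raiseEven_mul_raiseOdd (a : ℕ) : ∀ k' k : Fin (a + 1), (raiseEven a * raiseOdd a) k' k =
    if (k' : ℕ) = k + 1 then
      1 / 4 * (Real.sqrt ((((k : ℕ) + 1) * (a + 1 - 1 - k) : ℕ)) : ℂ) else 0 := by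
  intro k' k
  rw [Matrix.mul_apply]
  by_cases hk : (k : ℕ) < a
  · rw [Finset.sum_eq_single ⟨k, hk⟩]
    · simp only [raiseEven, raiseOdd, if_true]
      split_ifs with h
      · have h1 : (((((k : ℕ) + 1) * (a + 1 - 1 - k) : ℕ)) : ℝ)
            = (((k : ℕ) : ℝ) + 1) * ((a : ℝ) - (k : ℕ)) := by
          rw [Nat.add_sub_cancel, Nat.cast_mul, Nat.cast_sub hk.le]
          push_cast
          rfl
        rw [h1, Real.sqrt_mul (by positivity)]
        push_cast
        ring
      · rw [zero_mul]
    · intro r _ hr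
      simp only [raiseOdd]
      rw [if_neg fun h => hr (Fin.ext h.symm), mul_zero]
    · simp
  · rw [Finset.sum_eq_zero, if_neg]
    · have := k'.2; omega
    · intro r _
      simp only [raiseOdd]
      rw [if_neg, mul_zero]
      have := r.2
      omega

theorem raiseOdd_mul_raiseEven (a : ℕ) : ∀ r' r : Fin a, (raiseOdd a * raiseEven a) r' r =
    if (r' : ℕ) = r + 1 then
      1 / 4 * (Real.sqrt ((((r : ℕ) + 1) * (a - 1 - r) : ℕ)) : ℂ) else 0 := by
  intro r' r
  rw [Matrix.mul_apply, Finset.sum_eq_single r.succ]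
  · simp only [raiseEven, raiseOdd, Fin.val_succ, if_true]
    by_cases h : (r' : ℕ) = r + 1
    · have h1 : (((((r : ℕ) + 1) * (a - 1 - r) : ℕ)) : ℝ)
          = (((r : ℕ) : ℝ) + 1) * ((a : ℝ) - ((r : ℕ) + 1 : ℕ)) := by
        rw [Nat.sub_sub, add_comm 1, Nat.cast_mul, Nat.cast_sub (by omega)]
        push_cast
        rfl
      rw [if_pos h, if_pos h.symm, h1, Real.sqrt_mul (by positivity)]
      push_cast
      ring
    · rw [if_neg h, if_neg (Ne.symm h), zero_mul]
  · intro k _ hk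
    simp only [raiseEven]
    rw [if_neg (show ¬ (k : ℕ) = r + 1 from fun h => hk (Fin.ext h)), mul_zero]
  · simp

theorem Vplus_mul_Vplus (a : ℕ) :
    Vplus a * Vplus a = fromBlocks (raiseEven a * raiseOdd a) 0 0 (raiseOdd a * raiseEven a) := by
  rw [Vplus_eq, fromBlocks_multiply]
  simp

theorem Vminus_mul_Vminus (a : ℕ) : Vminus a * Vminus a
    = fromBlocks (-(raiseEven a * raiseOdd a)ᴴ) 0 0 (-(raiseOdd a * raiseEven a)ᴴ) := by
  rw [Vminus_eq, fromBlocks_multiply]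
  simp [conjTranspose_mul]

theorem spinGen_rot {N : ℕ} {E : Matrix (Fin N) (Fin N) ℂ}
    (hE : ∀ k' k : Fin N, E k' k = if (k' : ℕ) = k + 1 then
      1 / 4 * (Real.sqrt ((((k : ℕ) + 1) * (N - 1 - k) : ℕ)) : ℂ) else 0) :
    (4 : ℂ) • (E + -Eᴴ) = spinGen N !![0, 1; -1, 0] := by
  ext m k
  simp only [spinGen, Matrix.smul_apply, Matrix.add_apply, Matrix.neg_apply, conjTranspose_apply,
    smul_eq_mul, hE]
  have e1 : (!![0, 1; -1, 0] : Matrix (Fin 2) (Fin 2) ℂ) 0 0 = 0 := rfl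
  have e2 : (!![0, 1; -1, 0] : Matrix (Fin 2) (Fin 2) ℂ) 1 1 = 0 := rfl
  have e3 : (!![0, 1; -1, 0] : Matrix (Fin 2) (Fin 2) ℂ) 1 0 = -1 := rfl
  have e4 : (!![0, 1; -1, 0] : Matrix (Fin 2) (Fin 2) ℂ) 0 1 = 1 := rfl
  rw [e1, e2, e3, e4]
  by_cases h1 : (m : ℕ) = k + 1
  · have h2 : ¬ (k : ℕ) = m + 1 := by omega
    have h3 : ¬ (m : ℕ) + 1 = k := by omega
    have h4 : ¬ (m : ℕ) = k := by omega
    rw [if_pos h1, if_neg h2, if_neg h3, if_neg h4, if_pos h1]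
    simp
  · by_cases h2 : (k : ℕ) = m + 1
    · have h4 : ¬ (m : ℕ) = k := by omega
      have h5 : ((m : ℕ) + 1) * (N - 1 - m) = k * (N - k) := by
        rw [h2]; congr 1; omega
      rw [if_neg h1, if_pos h2, if_pos h2.symm, if_neg h4, if_neg h1, h5]
      simp
    · rw [if_neg h1, if_neg h2, if_neg (Ne.symm h2), if_neg h1]
      simp

theorem spinGen_diag (N : ℕ) : spinGen N !![-Complex.I, 0; 0, Complex.I]
    = (-Complex.I) • diagonal fun k : Fin N => 2 * ((k : ℕ) : ℂ) + 1 - N := by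
  ext m k
  have e1 : (!![-Complex.I, 0; 0, Complex.I] : Matrix (Fin 2) (Fin 2) ℂ) 0 0 = -Complex.I := rfl
  have e2 : (!![-Complex.I, 0; 0, Complex.I] : Matrix (Fin 2) (Fin 2) ℂ) 1 1 = Complex.I := rfl
  have e3 : (!![-Complex.I, 0; 0, Complex.I] : Matrix (Fin 2) (Fin 2) ℂ) 1 0 = 0 := rfl
  have e4 : (!![-Complex.I, 0; 0, Complex.I] : Matrix (Fin 2) (Fin 2) ℂ) 0 1 = 0 := rfl
  rw [spinGen, e1, e2, e3, e4, Matrix.smul_apply]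
  simp only [zero_mul, ite_self, add_zero]
  by_cases h : m = k
  · subst h
    have h5 : ((N - 1 - (m : ℕ) : ℕ) : ℂ) = (N : ℂ) - 1 - (m : ℕ) := by
      have := m.2
      rw [Nat.sub_sub, Nat.cast_sub (by omega)]
      push_cast
      ring
    rw [Matrix.diagonal_apply_eq, if_pos rfl, h5, smul_eq_mul]
    ring
  · rw [Matrix.diagonal_apply_ne _ h, if_neg fun h' => h (Fin.ext h'), smul_zero]

theorem hasDerivAt_fromBlocks {m n : Type*} [Fintype m] [Fintype n]
    {A : ℝ → Matrix m m ℂ} {B : ℝ → Matrix n n ℂ} {K : Matrix m m ℂ}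
    {L : Matrix n n ℂ} {s : ℝ}
    (hA : ∀ i k, HasDerivAt (fun s => A s i k) ((A s * K) i k) s)
    (hB : ∀ i k, HasDerivAt (fun s => B s i k) ((B s * L) i k) s) (i k : m ⊕ n) :
    HasDerivAt (fun s => fromBlocks (A s) 0 0 (B s) i k)
      ((fromBlocks (A s) 0 0 (B s) * fromBlocks K 0 0 L) i k) s := by
  rw [fromBlocks_multiply]
  rcases i with i | i <;> rcases k with k | k
  · simpa using hA i k
  · simpa using hasDerivAt_const s (0 : ℂ)
  · simpa using hasDerivAt_const s (0 : ℂ)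
  · simpa using hB i k

/-- The parity operator of `π_j`. -/
def idxGrading (a : ℕ) : Matrix (Idx a) (Idx a) ℂ := fromBlocks 1 0 0 (-1)

theorem irrep_grading (a : ℕ) : (irrep a).grading = idxGrading a := by
  apply Matrix.ext
  intro i k
  rcases i with i | i <;> rcases k with k | k
  · by_cases h : i = k
    · subst h
      exact (diagonal_apply_eq _ _).trans (by simp [idxGrading, irrep, sgn])
    · exact (diagonal_apply_ne _ fun h' => h (Sum.inl_injective h')).trans
        (by simp [idxGrading, h])
  · exact diagonal_apply_ne _ Sum.inl_ne_inr
  · exact diagonal_apply_ne _ Sum.inr_ne_inl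
  · by_cases h : i = k
    · subst h
      exact (diagonal_apply_eq _ _).trans (by simp [idxGrading, irrep, sgn])
    · exact (diagonal_apply_ne _ fun h' => h (Sum.inr_injective h')).trans
        (by simp [idxGrading, h])

theorem fromBlocks_mul_idxGrading (a : ℕ) (A : Matrix (Fin (a + 1)) (Fin (a + 1)) ℂ)
    (B : Matrix (Fin a) (Fin a) ℂ) :
    fromBlocks A 0 0 B * idxGrading a = idxGrading a * fromBlocks A 0 0 B := by
  rw [idxGrading, fromBlocks_multiply, fromBlocks_multiply]
  simp

theorem Vplus_mul_idxGrading (a : ℕ) : Vplus a * idxGrading a = -(idxGrading a * Vplus a) := by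
  rw [idxGrading, Vplus_eq, fromBlocks_multiply, fromBlocks_multiply, fromBlocks_neg]
  simp

theorem Vminus_mul_idxGrading (a : ℕ) : Vminus a * idxGrading a = -(idxGrading a * Vminus a) := by
  rw [idxGrading, Vminus_eq, fromBlocks_multiply, fromBlocks_multiply, fromBlocks_neg]
  simp

theorem diagonal_mul_Vplus (a : ℕ) : (diagonal fun i => (irrepWeight a i : ℂ)) * Vplus a
    = Vplus a * (diagonal fun i => (irrepWeight a i : ℂ)) + Vplus a := by
  ext i k
  rw [Matrix.add_apply, Matrix.diagonal_mul, Matrix.mul_diagonal]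
  rcases i with i | i <;> rcases k with k | k <;> simp only [Vplus, irrepWeight, Sum.elim_inl,
    Sum.elim_inr]
  · simp
  · split_ifs with h
    · rw [h]; push_cast; ring
    · simp
  · split_ifs with h
    · rw [h]; push_cast; ring
    · simp
  · simp

theorem diagonal_mul_Vminus (a : ℕ) : (diagonal fun i => (irrepWeight a i : ℂ)) * Vminus a
    = Vminus a * (diagonal fun i => (irrepWeight a i : ℂ)) - Vminus a := by
  ext i k
  rw [Matrix.sub_apply, Matrix.diagonal_mul, Matrix.mul_diagonal]
  rcases i with i | i <;> rcases k with k | k <;> simp only [Vminus, irrepWeight, Sum.elim_inl,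
    Sum.elim_inr]
  · simp
  · split_ifs with h
    · rw [h]; push_cast; ring
    · simp
  · split_ifs with h
    · rw [h]; push_cast; ring
    · simp
  · simp

theorem irrep_mat (a : ℕ) (g : SU2) (D : Matrix (Idx a) (Idx a) ℂ)
    (hD : D = fromBlocks (wignerD (a + 1) g) 0 0 (wignerD a g)) :
    (irrep a).mat g = scaled D 1 + scaled (D * Vplus a) etaBar + scaled (D * Vminus a) eta
      + scaled ((1 / 2 : ℂ) • (D * (Vplus a * Vminus a - Vminus a * Vplus a))) (etaBar * eta) := by
  have h : (irrep a).mat g = scaled D 1 * IsNilpotent.exp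
      (scaled (Vplus a) etaBar + scaled (Vminus a) eta) := by
    rw [hD, ← map_algebraMap_eq_scaled]
    rfl
  rw [h, exp_odd]
  simp only [mul_add, scaled_mul, one_mul, mul_one, Matrix.mul_smul]
  rfl

/-- The realization of `π_j`. -/
def irrepRealization (a : ℕ) : Realization (irrep a) where
  D g := fromBlocks (wignerD (a + 1) g) 0 0 (wignerD a g)
  Vp := Vplus a
  Vm := Vminus a
  w := irrepWeight a
  mat_eq g := irrep_mat a g _ rfl
  D_even g := by rw [irrep_grading]; exact fromBlocks_mul_idxGrading a _ _
  Vp_odd := by rw [irrep_grading]; exact Vplus_mul_idxGrading a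
  Vm_odd := by rw [irrep_grading]; exact Vminus_mul_idxGrading a
  D_one := by
    rw [wignerD_one, wignerD_one]
    exact fromBlocks_one
  anticomm := by
    show Vplus a * Vminus a + Vminus a * Vplus a
      = (-1 / 4 : ℂ) • diagonal fun i : Idx a => (irrepWeight a i : ℂ)
    rw [diagonal_irrepWeight, Vplus_mul_Vminus, Vminus_mul_Vplus, fromBlocks_diagonal,
      fromBlocks_diagonal, fromBlocks_diagonal, diagonal_add, ← diagonal_smul]
    congr 1
    ext (i | i) <;> simp <;> ring
  shift_Vp := diagonal_mul_Vplus a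
  shift_Vm := diagonal_mul_Vminus a
  adjoint := by
    show (Vplus a * Vplus a)ᴴ = -(Vminus a * Vminus a)
    rw [Vplus_mul_Vplus, Vminus_mul_Vminus, fromBlocks_conjTranspose, fromBlocks_neg]
    simp
  deriv_diag h s i k := by
    show HasDerivAt (fun s => fromBlocks (wignerD (a + 1) (h * diagSU s)) 0 0
        (wignerD a (h * diagSU s)) i k)
      ((fromBlocks (wignerD (a + 1) (h * diagSU s)) 0 0 (wignerD a (h * diagSU s))
        * ((-Complex.I) • diagonal fun i : Idx a => (irrepWeight a i : ℂ))) i k) s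
    have e : ((-Complex.I) • diagonal fun i : Idx a => (irrepWeight a i : ℂ))
        = fromBlocks (spinGen (a + 1) !![-Complex.I, 0; 0, Complex.I]) 0 0
            (spinGen a !![-Complex.I, 0; 0, Complex.I]) := by
      rw [diagonal_irrepWeight, fromBlocks_smul, spinGen_diag, spinGen_diag, smul_zero, smul_zero]
      congr 3
      ext k
      push_cast
      ring
    rw [e]
    exact hasDerivAt_fromBlocks
      (fun i k => hasDerivAt_wignerD (a + 1) (hasDerivAt_mul_diagSU h s) i k)
      (fun i k => hasDerivAt_wignerD a (hasDerivAt_mul_diagSU h s) i k) i k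
  deriv_rot h s i k := by
    show HasDerivAt (fun s => fromBlocks (wignerD (a + 1) (h * rotSU s)) 0 0
        (wignerD a (h * rotSU s)) i k)
      ((fromBlocks (wignerD (a + 1) (h * rotSU s)) 0 0 (wignerD a (h * rotSU s))
        * ((4 : ℂ) • (Vplus a * Vplus a + Vminus a * Vminus a))) i k) s
    have e : ((4 : ℂ) • (Vplus a * Vplus a + Vminus a * Vminus a))
        = fromBlocks (spinGen (a + 1) !![0, 1; -1, 0]) 0 0 (spinGen a !![0, 1; -1, 0]) := by
      rw [Vplus_mul_Vplus, Vminus_mul_Vminus, fromBlocks_add, fromBlocks_smul,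
        spinGen_rot (raiseEven_mul_raiseOdd a), spinGen_rot (raiseOdd_mul_raiseEven a)]
      simp
    rw [e]
    exact hasDerivAt_fromBlocks
      (fun i k => hasDerivAt_wignerD (a + 1) (hasDerivAt_mul_rotSU h s) i k)
      (fun i k => hasDerivAt_wignerD a (hasDerivAt_mul_rotSU h s) i k) i k

/-! ### Invariant vectors -/

theorem scaled_mulVec {m n : Type*} [Fintype n] (A : Matrix m n ℂ) (x : Grassmann) (v : n → ℂ) :
    (scaled A x).mulVec (fun i => algebraMap ℂ Grassmann (v i)) = fun i => (A *ᵥ v) i • x := by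
  ext i
  simp only [Matrix.mulVec, dotProduct, scaled_apply, Finset.sum_smul]
  refine Finset.sum_congr rfl fun j _ => ?_
  rw [Algebra.algebraMap_eq_smul_one, smul_mul_smul_comm, mul_one]

/-- Every element of `SU(2)` has Euler angles. -/
theorem exists_euler (g : SU2) : ∃ x y z : ℝ, g = diagSU x * rotSU y * diagSU z := by
  obtain ⟨M, hM⟩ := g
  obtain ⟨hU, hdet⟩ := Matrix.mem_specialUnitaryGroup_iff.1 hM
  rw [Matrix.mem_unitaryGroup_iff] at hU
  have h00 := congrFun (congrFun hU 0) 0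
  have h10 := congrFun (congrFun hU 1) 0
  simp only [Matrix.mul_apply, Fin.sum_univ_two, Matrix.star_apply, RCLike.star_def,
    Matrix.one_apply_eq, ne_eq, one_ne_zero, not_false_eq_true, Matrix.one_apply_ne] at h00 h10
  rw [Matrix.det_fin_two] at hdet
  -- Unitarity and determinant one express the second row through the first.
  have e11 : M 1 1 = (starRingEnd ℂ) (M 0 0) := by
    linear_combination (-(M 1 1)) * h00 + (M 0 1) * h10 + (starRingEnd ℂ) (M 0 0) * hdet
  have e10 : M 1 0 = -(starRingEnd ℂ) (M 0 1) := by
    linear_combination (-(M 1 0)) * h00 + (M 0 0) * h10 - (starRingEnd ℂ) (M 0 1) * hdet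
  have hn : ‖M 0 0‖ ^ 2 + ‖M 0 1‖ ^ 2 = 1 := by
    rw [Complex.mul_conj', Complex.mul_conj'] at h00
    exact_mod_cast h00
  have hc : Real.cos (Real.arccos ‖M 0 0‖) = ‖M 0 0‖ :=
    Real.cos_arccos (by linarith [norm_nonneg (M 0 0)])
      (by nlinarith [norm_nonneg (M 0 0), sq_nonneg ‖M 0 1‖])
  have hs : Real.sin (Real.arccos ‖M 0 0‖) = ‖M 0 1‖ := by
    rw [Real.sin_arccos, show 1 - ‖M 0 0‖ ^ 2 = ‖M 0 1‖ ^ 2 by linarith,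
      Real.sqrt_sq (norm_nonneg _)]
  have h0 := Complex.norm_mul_exp_arg_mul_I (M 0 0)
  have h1 := Complex.norm_mul_exp_arg_mul_I (M 0 1)
  have h0' := congrArg (starRingEnd ℂ) h0
  have h1' := congrArg (starRingEnd ℂ) h1
  simp only [map_mul, Complex.conj_ofReal, ← Complex.exp_conj, Complex.conj_I] at h0' h1'
  set α := Complex.arg (M 0 0)
  set β := Complex.arg (M 0 1)
  -- The outer angles solve x + z = -arg M₀₀ and z - x = arg M₀₁; the middle one has cosine |M₀₀|
  -- and sine |M₀₁|.
  refine ⟨-(α + β) / 2, Real.arccos ‖M 0 0‖, (β - α) / 2, Subtype.ext ?_⟩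
  simp only [Submonoid.coe_mul, diagSU, rotSU, hc, hs]
  have key : ∀ u v w : ℂ, u + v = w → Complex.exp u * Complex.exp v = Complex.exp w := by
    intro u v w h
    rw [← Complex.exp_add, h]
  ext i j
  fin_cases i <;> fin_cases j <;> simp [Matrix.mul_apply, Fin.sum_univ_two]
  · rw [mul_right_comm, key _ _ ((α : ℂ) * Complex.I) (by ring), mul_comm]
    exact h0.symm
  · rw [mul_right_comm, key _ _ ((β : ℂ) * Complex.I) (by ring), mul_comm]
    exact h1.symm
  · rw [e10, ← h1', mul_right_comm, key _ _ ((β : ℂ) * -Complex.I) (by ring), mul_comm]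
  · rw [e11, ← h0', mul_right_comm, key _ _ ((α : ℂ) * -Complex.I) (by ring), mul_comm]

/-- The derivative of A v is A K v = 0, so A v is constant along the curve. -/
theorem mulVec_eq_of_hasDerivAt {m : Type*} [Fintype m] {A : ℝ → Matrix m m ℂ}
    {K : Matrix m m ℂ} {v : m → ℂ} (hK : K *ᵥ v = 0)
    (hA : ∀ s i k, HasDerivAt (fun s => A s i k) ((A s * K) i k) s) (s : ℝ) :
    A s *ᵥ v = A 0 *ᵥ v := by
  ext i
  have hd : ∀ s, HasDerivAt (fun s => (A s *ᵥ v) i) 0 s := by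
    intro s
    have h : HasDerivAt (fun s => (A s *ᵥ v) i) (((A s * K) *ᵥ v) i) s := by
      simp only [Matrix.mulVec, dotProduct]
      exact HasDerivAt.fun_sum fun k _ => (hA s i k).mul_const _
    rwa [← Matrix.mulVec_mulVec, hK, Matrix.mulVec_zero] at h
  exact is_const_of_deriv_eq_zero (fun s => (hd s).differentiableAt) (fun s => (hd s).deriv) s 0

namespace Realization

variable {R : SuperMatrix} (r : Realization R)

/-- The weight operator. -/
def H : Matrix R.ι R.ι ℂ := Matrix.diagonal fun i => (r.w i : ℂ)

/-- The generators of both one-parameter subgroups are polynomials in V₊ and V₋ without constant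
term, hence kill v; Euler angles then reach all of `SU(2)`. -/
theorem D_mulVec {v : R.ι → ℂ} (hp : r.Vp *ᵥ v = 0) (hm : r.Vm *ᵥ v = 0) (g : SU2) :
    r.D g *ᵥ v = v := by
  have hH : r.H *ᵥ v = 0 := by
    have h := congrArg (· *ᵥ v) r.anticomm
    simp only [Matrix.add_mulVec, ← Matrix.mulVec_mulVec, hp, hm, Matrix.mulVec_zero,
      add_zero, Matrix.smul_mulVec] at h
    exact (smul_eq_zero.1 h.symm).resolve_left (by norm_num)
  have hdiag : ∀ h s, r.D (h * diagSU s) *ᵥ v = r.D h *ᵥ v := by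
    intro h s
    rw [mulVec_eq_of_hasDerivAt (A := fun s => r.D (h * diagSU s))
      (by rw [Matrix.smul_mulVec]; exact (congrArg _ hH).trans (smul_zero _)) (r.deriv_diag h) s]
    simp only [diagSU_zero, mul_one]
  have hrot : ∀ h s, r.D (h * rotSU s) *ᵥ v = r.D h *ᵥ v := by
    intro h s
    rw [mulVec_eq_of_hasDerivAt (A := fun s => r.D (h * rotSU s)) _ (r.deriv_rot h) s]
    · simp only [rotSU_zero, mul_one]
    · simp [Matrix.smul_mulVec, Matrix.add_mulVec, ← Matrix.mulVec_mulVec, hp, hm]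
  obtain ⟨x, y, z, rfl⟩ := exists_euler g
  rw [hdiag, hrot, ← one_mul (diagSU x), hdiag, r.D_one, Matrix.one_mulVec]

/-- At g = 1 the coefficients of η̄ and η are V₊v and V₋v. Conversely, if both vanish, so does the
η̄η term, and `D_mulVec` gives invariance under `SU(2)`. -/
theorem mem_invariants_iff (v : R.ι → ℂ) :
    v ∈ R.invariants ↔ r.Vp *ᵥ v = 0 ∧ r.Vm *ᵥ v = 0 := by
  have hmat : ∀ g, (R.mat g).mulVec (fun i => algebraMap ℂ Grassmann (v i))
      = fun i => (r.D g *ᵥ v) i • (1 : Grassmann) + ((r.D g * r.Vp) *ᵥ v) i • etaBar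
        + ((r.D g * r.Vm) *ᵥ v) i • eta
        + (((1 / 2 : ℂ) • (r.D g * (r.Vp * r.Vm - r.Vm * r.Vp))) *ᵥ v) i • (etaBar * eta) := by
    intro g
    rw [r.mat_eq, Matrix.add_mulVec, Matrix.add_mulVec, Matrix.add_mulVec, scaled_mulVec,
      scaled_mulVec, scaled_mulVec, scaled_mulVec]
    rfl
  constructor
  · intro hv
    have h1 := (hmat 1).symm.trans (hv 1)
    rw [r.D_one, one_mul, one_mul, one_mul] at h1
    have h2 : ∀ i, (![(r.Vp *ᵥ v) i, (r.Vm *ᵥ v) i] : Fin 2 → ℂ) = 0 := by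
      intro i
      have h3 := congrArg ExteriorAlgebra.ιInv (congrFun h1 i)
      simp only [map_add, map_smul, ιInv_one, ιInv_etaBar, ιInv_eta, ιInv_etaBar_mul_eta,
        ιInv_algebraMap] at h3
      rw [← h3]
      ext j
      fin_cases j <;> simp
    exact ⟨funext fun i => congrFun (h2 i) 0, funext fun i => congrFun (h2 i) 1⟩
  · rintro ⟨hp, hm⟩ g
    rw [hmat g]
    ext i
    have h4 : (((1 / 2 : ℂ) • (r.D g * (r.Vp * r.Vm - r.Vm * r.Vp))) *ᵥ v) = 0 := by
      rw [Matrix.smul_mulVec, ← Matrix.mulVec_mulVec, Matrix.sub_mulVec, ← Matrix.mulVec_mulVec,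
        ← Matrix.mulVec_mulVec, hp, hm]
      simp
    rw [h4, ← Matrix.mulVec_mulVec, ← Matrix.mulVec_mulVec, hp, hm, r.D_mulVec hp hm]
    simp [Algebra.algebraMap_eq_smul_one]

/-! ### The highest weight argument -/

/-- The space of vectors of weight `k`. -/
def weightSpace (k : ℤ) : Submodule ℂ (R.ι → ℂ) :=
  LinearMap.ker (Matrix.toLin' (Matrix.diagonal fun i => (r.w i : ℂ) - k))

theorem mem_weightSpace_iff (k : ℤ) (v : R.ι → ℂ) :
    v ∈ r.weightSpace k ↔ ∀ i, r.w i ≠ k → v i = 0 := by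
  rw [weightSpace, LinearMap.mem_ker, Matrix.toLin'_apply, funext_iff]
  refine forall_congr' fun i => ?_
  rw [Matrix.mulVec_diagonal, Pi.zero_apply, mul_eq_zero, sub_eq_zero, Int.cast_inj]
  tauto

theorem mem_weightSpace_iff_H (k : ℤ) (v : R.ι → ℂ) :
    v ∈ r.weightSpace k ↔ r.H *ᵥ v = (k : ℂ) • v := by
  rw [weightSpace, LinearMap.mem_ker, Matrix.toLin'_apply, funext_iff, funext_iff]
  refine forall_congr' fun i => ?_
  rw [Matrix.mulVec_diagonal, H, Matrix.mulVec_diagonal, Pi.zero_apply, sub_mul, sub_eq_zero]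
  rfl

theorem finrank_weightSpace (k : ℤ) :
    Module.finrank ℂ (r.weightSpace k) = (Finset.univ.filter fun i => r.w i = k).card := by
  have h1 := LinearMap.finrank_range_add_finrank_ker
    (Matrix.toLin' (Matrix.diagonal fun i => (r.w i : ℂ) - k))
  have h2 : Module.finrank ℂ (LinearMap.range
      (Matrix.toLin' (Matrix.diagonal fun i => (r.w i : ℂ) - k)))
      = (Finset.univ.filter fun i => ¬ r.w i = k).card := by
    have h3 := Matrix.rank_diagonal fun i => (r.w i : ℂ) - k
    rw [Fintype.card_subtype] at h3
    simp only [ne_eq, sub_eq_zero, Int.cast_inj] at h3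
    rw [← h3]
    rfl
  rw [h2, Module.finrank_fintype_fun_eq_card] at h1
  have h4 : (Finset.univ.filter fun i => r.w i = k).card
      + (Finset.univ.filter fun i => ¬ r.w i = k).card = Fintype.card R.ι := by
    rw [← Finset.card_univ]
    exact Finset.card_filter_add_card_filter_not _
  rw [add_comm] at h4
  exact Nat.add_left_cancel (h1.trans h4.symm)

theorem Vp_mem {k l : ℤ} (hl : k + 1 = l) {v : R.ι → ℂ} (hv : v ∈ r.weightSpace k) :
    r.Vp *ᵥ v ∈ r.weightSpace l := by
  subst hl
  rw [mem_weightSpace_iff_H] at hv ⊢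
  have h : r.H * r.Vp = r.Vp * r.H + r.Vp := r.shift_Vp
  rw [Matrix.mulVec_mulVec, h, Matrix.add_mulVec, ← Matrix.mulVec_mulVec, hv, Matrix.mulVec_smul]
  push_cast
  module

theorem Vm_mem {k l : ℤ} (hl : k - 1 = l) {v : R.ι → ℂ} (hv : v ∈ r.weightSpace k) :
    r.Vm *ᵥ v ∈ r.weightSpace l := by
  subst hl
  rw [mem_weightSpace_iff_H] at hv ⊢
  have h : r.H * r.Vm = r.Vm * r.H - r.Vm := r.shift_Vm
  rw [Matrix.mulVec_mulVec, h, Matrix.sub_mulVec, ← Matrix.mulVec_mulVec, hv, Matrix.mulVec_smul]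
  push_cast
  module

/-- This is [J₊, J₋] = 2J₃ rescaled, obtained by moving V₋ through V₊² with the anticommutator and
the weight shift alone. -/
theorem commutator_sq : r.Vp * r.Vp * (r.Vm * r.Vm) - r.Vm * r.Vm * (r.Vp * r.Vp)
    = (-1 / 16 : ℂ) • r.H := by
  have ha : r.Vp * r.Vm = (-1 / 4 : ℂ) • r.H - r.Vm * r.Vp := eq_sub_of_add_eq r.anticomm
  have hs : r.H * r.Vp = r.Vp * r.H + r.Vp := r.shift_Vp
  have hc : r.Vp * r.Vp * r.Vm = r.Vm * (r.Vp * r.Vp) + (1 / 4 : ℂ) • r.Vp := by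
    rw [mul_assoc, ha, mul_sub, ← mul_assoc, ha, sub_mul, Matrix.mul_smul, Matrix.smul_mul, hs,
      mul_assoc]
    module
  rw [← mul_assoc, hc, add_mul, mul_assoc r.Vm, hc, mul_add, Matrix.smul_mul, Matrix.mul_smul, ha,
    ← mul_assoc, ← mul_assoc]
  module

theorem Vm_sq_eq : r.Vm * r.Vm = -(r.Vp * r.Vp)ᴴ := by rw [r.adjoint, neg_neg]

theorem dotProduct_Vm_sq (x y : R.ι → ℂ) :
    star x ⬝ᵥ ((r.Vm * r.Vm) *ᵥ y) = -(star ((r.Vp * r.Vp) *ᵥ x) ⬝ᵥ y) := by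
  rw [Vm_sq_eq, Matrix.neg_mulVec, dotProduct_neg, Matrix.dotProduct_mulVec, Matrix.star_mulVec]

open scoped ComplexOrder in
theorem re_star_dotProduct_self_nonneg (x : R.ι → ℂ) : 0 ≤ (star x ⬝ᵥ x).re :=
  (Complex.nonneg_iff.1 (dotProduct_star_self_nonneg x)).1

open scoped ComplexOrder in
theorem eq_zero_of_re_dotProduct {x : R.ι → ℂ} (h : (star x ⬝ᵥ x).re ≤ 0) : x = 0 := by
  have h1 := Complex.nonneg_iff.1 (dotProduct_star_self_nonneg x)
  have h2 : star x ⬝ᵥ x = 0 := Complex.ext (le_antisymm h h1.1) h1.2.symm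
  exact dotProduct_star_self_eq_zero.1 h2

/-- The square of the raising operator after that of the lowering operator is injective on positive
weights. -/
theorem eq_zero_of_pos {k : ℤ} (hk : 0 < k) {x : R.ι → ℂ} (hx : x ∈ r.weightSpace k)
    (h : (r.Vp * r.Vp * (r.Vm * r.Vm)) *ᵥ x = 0) : x = 0 := by
  rw [mem_weightSpace_iff_H] at hx
  have h1 : (r.Vm * r.Vm) *ᵥ ((r.Vp * r.Vp) *ᵥ x) = ((k : ℂ) / 16) • x := by
    have h2 := congrArg (· *ᵥ x) r.commutator_sq
    simp only [Matrix.sub_mulVec, h, Matrix.smul_mulVec, hx] at h2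
    rw [Matrix.mulVec_mulVec]
    rw [zero_sub, neg_eq_iff_eq_neg] at h2
    rw [h2]
    module
  -- Pairing with x gives -|V₊²x|² = (k/16)|x|², which for k > 0 forces x = 0.
  have h3 := congrArg (fun y => star x ⬝ᵥ y) h1
  simp only [r.dotProduct_Vm_sq, dotProduct_smul, smul_eq_mul] at h3
  have h4 := congrArg Complex.re h3
  have h5 : ((k : ℂ) / 16) = (((k : ℝ) / 16 : ℝ) : ℂ) := by push_cast; rfl
  rw [h5, Complex.re_ofReal_mul, Complex.neg_re] at h4
  have h6 := re_star_dotProduct_self_nonneg ((r.Vp * r.Vp) *ᵥ x)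
  have hk' : (0 : ℝ) < (k : ℝ) / 16 := by positivity
  apply eq_zero_of_re_dotProduct
  by_contra hcon
  have := mul_pos hk' (not_le.1 hcon)
  linarith

/-- V₊²V₋² preserves the weight-one space and is injective on it, hence surjective by finite
dimension. Splitting off the leftmost V₊ leaves a preimage of weight zero. -/
theorem exists_Vp_eq {y : R.ι → ℂ} (hy : y ∈ r.weightSpace 1) :
    ∃ x ∈ r.weightSpace 0, r.Vp *ᵥ x = y := by
  set T : (R.ι → ℂ) →ₗ[ℂ] (R.ι → ℂ) := Matrix.toLin' (r.Vp * r.Vp * (r.Vm * r.Vm)) with hT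
  have hTa : ∀ x, T x = r.Vp *ᵥ (r.Vp *ᵥ (r.Vm *ᵥ (r.Vm *ᵥ x))) := by
    intro x
    simp [hT, Matrix.mulVec_mulVec, mul_assoc]
  have hmem : ∀ x ∈ r.weightSpace 1, r.Vp *ᵥ (r.Vm *ᵥ (r.Vm *ᵥ x)) ∈ r.weightSpace 0 :=
    fun x hx => r.Vp_mem (k := -1) (by norm_num) (r.Vm_mem (k := 0) (by norm_num) (r.Vm_mem (k := 1) (by norm_num) hx))
  have hW : ∀ x ∈ r.weightSpace 1, T x ∈ r.weightSpace 1 := by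
    intro x hx
    rw [hTa]
    exact r.Vp_mem (k := 0) (by norm_num) (hmem x hx)
  have hinj : Function.Injective (T.restrict hW) := by
    rw [← LinearMap.ker_eq_bot, LinearMap.ker_eq_bot']
    intro x hx
    have h := congrArg Subtype.val hx
    exact Subtype.ext (r.eq_zero_of_pos one_pos x.2 h)
  obtain ⟨x, hx⟩ := LinearMap.surjective_of_injective hinj ⟨y, hy⟩
  refine ⟨_, hmem x x.2, ?_⟩
  rw [← hTa]
  exact congrArg Subtype.val hx

/-- Positivity gives V₋²v = 0. Then V₊ and V₋ both kill u = V₋v, so Hu = 0; but u has weight -1,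
hence u = 0. -/
theorem Vm_eq_zero {v : R.ι → ℂ} (hv : v ∈ r.weightSpace 0) (hp : r.Vp *ᵥ v = 0) :
    r.Vm *ᵥ v = 0 := by
  have hH : r.H *ᵥ v = 0 := by
    rw [mem_weightSpace_iff_H] at hv
    simpa using hv
  have hF : (r.Vm * r.Vm) *ᵥ v = 0 := by
    have h2 := congrArg (· *ᵥ v) r.commutator_sq
    simp only [Matrix.sub_mulVec, Matrix.smul_mulVec, hH, ← Matrix.mulVec_mulVec, hp,
      Matrix.mulVec_zero, smul_zero, sub_zero] at h2
    have h3 : (r.Vm * r.Vm) *ᵥ v = -((r.Vp * r.Vp)ᴴ *ᵥ v) := by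
      rw [Vm_sq_eq, Matrix.neg_mulVec]
    apply eq_zero_of_re_dotProduct
    nth_rewrite 1 [h3]
    rw [star_neg, neg_dotProduct, Matrix.star_mulVec, Matrix.conjTranspose_conjTranspose,
      ← Matrix.dotProduct_mulVec, ← Matrix.mulVec_mulVec, ← Matrix.mulVec_mulVec, h2]
    simp
  set u := r.Vm *ᵥ v with hu
  have hu1 : u ∈ r.weightSpace (-1) := r.Vm_mem (k := 0) (by norm_num) hv
  have hpu : r.Vp *ᵥ u = 0 := by
    have h := congrArg (· *ᵥ v) r.anticomm
    simp only [Matrix.add_mulVec, ← Matrix.mulVec_mulVec, hp, Matrix.mulVec_zero, add_zero,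
      Matrix.smul_mulVec] at h
    exact h.trans ((congrArg _ hH).trans (smul_zero _))
  have hmu : r.Vm *ᵥ u = 0 := by rw [hu, Matrix.mulVec_mulVec, hF]
  have hHu : r.H *ᵥ u = 0 := by
    have h := congrArg (· *ᵥ u) r.anticomm
    simp only [Matrix.add_mulVec, ← Matrix.mulVec_mulVec, hpu, hmu, Matrix.mulVec_zero, add_zero,
      Matrix.smul_mulVec] at h
    exact (smul_eq_zero.1 h.symm).resolve_left (by norm_num)
  rw [mem_weightSpace_iff_H, hHu] at hu1
  exact (smul_eq_zero.1 hu1.symm).resolve_left (by norm_num)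

theorem invariants_eq :
    R.invariants = r.weightSpace 0 ⊓ LinearMap.ker (Matrix.toLin' r.Vp) := by
  ext v
  rw [r.mem_invariants_iff, Submodule.mem_inf, LinearMap.mem_ker, Matrix.toLin'_apply]
  constructor
  · rintro ⟨hp, hm⟩
    refine ⟨?_, hp⟩
    have h := congrArg (· *ᵥ v) r.anticomm
    simp only [Matrix.add_mulVec, ← Matrix.mulVec_mulVec, hp, hm, Matrix.mulVec_zero, add_zero,
      Matrix.smul_mulVec] at h
    rw [mem_weightSpace_iff_H, Int.cast_zero, zero_smul]
    exact (smul_eq_zero.1 h.symm).resolve_left (by norm_num)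
  · rintro ⟨hv, hp⟩
    exact ⟨hp, r.Vm_eq_zero hv hp⟩

/-- Rank–nullity for V₊ : W₀ → W₁, which is onto by `exists_Vp_eq` and has the invariants as kernel
by `invariants_eq`. -/
theorem numInvariants_add :
    R.numInvariants + (Finset.univ.filter fun i => r.w i = 1).card
      = (Finset.univ.filter fun i => r.w i = 0).card := by
  have hmap : ∀ x ∈ r.weightSpace 0, Matrix.toLin' r.Vp x ∈ r.weightSpace 1 := by
    intro x hx
    rw [Matrix.toLin'_apply]
    exact r.Vp_mem (k := 0) (by norm_num) hx
  set f := (Matrix.toLin' r.Vp).restrict hmap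
  have hsurj : LinearMap.range f = ⊤ := by
    rw [LinearMap.range_eq_top]
    intro y
    obtain ⟨x, hx, hxy⟩ := r.exists_Vp_eq y.2
    exact ⟨⟨x, hx⟩, Subtype.ext (by simpa [f] using hxy)⟩
  have h1 := LinearMap.finrank_range_add_finrank_ker f
  rw [hsurj, finrank_top, finrank_weightSpace, finrank_weightSpace] at h1
  have h2 : Module.finrank ℂ (LinearMap.ker f) = R.numInvariants := by
    rw [SuperMatrix.numInvariants, r.invariants_eq, LinearMap.ker_restrict,
      ← Submodule.finrank_map_subtype_eq, Submodule.map_comap_subtype]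
  rw [← h2, add_comm]
  exact h1

/-- If parities and weights agree up to a shift, all invariant vectors have the same parity. -/
theorem superNumInvariants_eq {c : ZMod 2} (hc : ∀ i, R.parity i = r.w i + c) :
    (R.superNumInvariants : ℂ) = sgn c * R.numInvariants := by
  -- Invariant vectors are supported on weight zero, where the parity is c.
  have h0 : ∀ v ∈ R.invariants, v ∈ R.homogeneous c := by
    intro v hv i hi
    rw [r.invariants_eq] at hv
    refine (r.mem_weightSpace_iff 0 v).1 hv.1 i fun hw => hi ?_
    rw [hc, hw, Int.cast_zero, zero_add]
  have h1 : R.invariants ⊓ R.homogeneous c = R.invariants := inf_eq_left.2 h0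
  have h2 : R.invariants ⊓ R.homogeneous (c + 1) = ⊥ := by
    rw [eq_bot_iff]
    intro v hv
    rw [Submodule.mem_bot]
    ext i
    by_cases hi : R.parity i = c
    · exact hv.2 i (by rw [hi]; simp)
    · exact h0 v hv.1 i hi
  rw [SuperMatrix.superNumInvariants, SuperMatrix.numInvariants]
  rcases zmod_two_cases c with rfl | rfl
  · rw [zero_add] at h2
    rw [h1, h2, sgn_zero]
    simp
  · rw [show (1 + 1 : ZMod 2) = 0 by decide] at h2
    rw [h1, h2, sgn_one]
    simp

end Realization

/-! ### Characters -/

open Polynomial in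
/-- The trace of the symmetric power of a two-by-two matrix of determinant one is a Chebyshev
polynomial in its trace. -/
theorem sum_coeff_eq_chebyshev {α β γ δ : ℂ} (hdet : α * δ - β * γ = 1) (n : ℕ) :
    ∑ x ∈ Finset.HasAntidiagonal.antidiagonal n, ((C α * X + C γ) ^ x.1 * (C β * X + C δ) ^ x.2).coeff x.1
      = (Chebyshev.S ℂ n).eval (α + δ) := by
  set L1 : ℂ[X] := C α * X + C γ with hL1
  set L2 : ℂ[X] := C β * X + C δ with hL2
  have c1 : ∀ (q : ℂ[X]) k, (q * L1).coeff (k + 1) = α * q.coeff k + γ * q.coeff (k + 1) := by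
    intro q k
    rw [hL1, mul_add, coeff_add, ← mul_assoc, coeff_mul_X, coeff_mul_C, coeff_mul_C]
    ring
  have c2 : ∀ (q : ℂ[X]) k, (q * L2).coeff (k + 1) = β * q.coeff k + δ * q.coeff (k + 1) := by
    intro q k
    rw [hL2, mul_add, coeff_add, ← mul_assoc, coeff_mul_X, coeff_mul_C, coeff_mul_C]
    ring
  have c0 : ∀ m, (L2 ^ m).coeff 0 = δ ^ m := by
    intro m
    rw [coeff_zero_eq_eval_zero, eval_pow, hL2]
    simp
  have hdeg : ∀ m, (L1 ^ m).coeff (m + 1) = 0 := by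
    intro m
    apply coeff_eq_zero_of_natDegree_lt
    have h1 : L1.natDegree ≤ 1 := natDegree_linear_le
    have h2 := natDegree_pow_le (p := L1) (n := m)
    nlinarith
  -- T is the trace; its recursion does not close alone, so the sum Q of coefficients one degree
  -- higher is carried along.
  set T : ℕ → ℂ := fun n => ∑ x ∈ Finset.HasAntidiagonal.antidiagonal n, (L1 ^ x.1 * L2 ^ x.2).coeff x.1 with hT
  set Q : ℕ → ℂ := fun n => ∑ x ∈ Finset.HasAntidiagonal.antidiagonal n, (L1 ^ x.1 * L2 ^ x.2).coeff (x.1 + 1)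
    with hQ
  have hT0 : T 0 = 1 := by simp [hT]
  have hQ0 : Q 0 = 0 := by simp [hQ, coeff_one]
  have hTs : ∀ n, T (n + 1) = δ ^ (n + 1) + α * T n + γ * Q n := by
    intro n
    simp only [hT, hQ, Finset.Nat.sum_antidiagonal_succ, pow_zero, one_mul, c0, Finset.mul_sum]
    rw [add_assoc, ← Finset.sum_add_distrib]
    congr 1
    refine Finset.sum_congr rfl fun x _ => ?_
    rw [pow_succ, mul_right_comm, c1]
  have hQs : ∀ n, Q (n + 1) = β * T n + δ * Q n := by
    intro n
    simp only [hT, hQ, Finset.Nat.sum_antidiagonal_succ', pow_zero, mul_one, hdeg, zero_add,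
      Finset.mul_sum]
    rw [← Finset.sum_add_distrib]
    refine Finset.sum_congr rfl fun x _ => ?_
    rw [pow_succ, ← mul_assoc, c2]
  have key : ∀ n : ℕ, T n = (Chebyshev.S ℂ n).eval (α + δ) ∧
      T (n + 1) = (Chebyshev.S ℂ (n + 1)).eval (α + δ) := by
    intro n
    induction n with
    | zero =>
      refine ⟨by simp [hT0], ?_⟩
      rw [hTs, hT0, hQ0]
      simp
      ring
    | succ n ih =>
      refine ⟨by exact_mod_cast ih.2, ?_⟩
      have h := Chebyshev.S_add_two ℂ (n : ℤ)
      rw [show ((n + 1 : ℕ) : ℤ) + 1 = (n : ℤ) + 2 by push_cast; ring, h, eval_sub, eval_mul,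
        eval_X, ← ih.1, ← ih.2, hTs (n + 1), hQs]
      have h3 := hTs n
      rw [pow_succ]
      -- Q is eliminated through the previous step; determinant one yields the Chebyshev recursion.
      linear_combination (-δ) * h3 - T n * hdet
  exact (key n).1

theorem trace_wignerD (N : ℕ) (g : SU2) :
    (wignerD N g).trace = (Polynomial.Chebyshev.S ℂ ((N : ℤ) - 1)).eval (g.1 0 0 + g.1 1 1) := by
  rcases N with _ | n
  -- The integer index N - 1 matters here: the empty matrix corresponds to S₋₁ = 0.
  · simp [Matrix.trace]
  · have hdet : g.1 0 0 * g.1 1 1 - g.1 0 1 * g.1 1 0 = 1 := by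
      rw [← Matrix.det_fin_two]
      exact (Matrix.mem_specialUnitaryGroup_iff.1 g.2).2
    rw [show ((n + 1 : ℕ) : ℤ) - 1 = n by push_cast; ring, ← sum_coeff_eq_chebyshev hdet n,
      Finset.Nat.sum_antidiagonal_eq_sum_range_succ_mk, Matrix.trace, Finset.sum_range]
    refine Finset.sum_congr rfl fun k _ => ?_
    rw [Matrix.diag_apply, wignerD_apply, div_self (by positivity), Complex.ofReal_one, one_mul]
    rfl

/-- The body of the super character `χ_j` as a polynomial in the trace, `a = 2j`. -/
def charBody (a : ℕ) : Polynomial ℝ :=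
  Polynomial.Chebyshev.S ℝ a - Polynomial.Chebyshev.S ℝ ((a : ℤ) - 1)

/-- The coefficient of `η̄ η` of the super character `χ_j` as a polynomial in the trace. -/
def charSoul (a : ℕ) : Polynomial ℝ :=
  Polynomial.C (-1 / 8 : ℝ) * (Polynomial.C (a : ℝ) * Polynomial.Chebyshev.S ℝ a
    + Polynomial.C ((a : ℝ) + 1) * Polynomial.Chebyshev.S ℝ ((a : ℤ) - 1))

theorem eval_chebyshev_ofReal (n : ℤ) (t : ℝ) :
    (Polynomial.Chebyshev.S ℂ n).eval (t : ℂ) = ((Polynomial.Chebyshev.S ℝ n).eval t : ℝ) := by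
  rw [← Polynomial.Chebyshev.map_S (algebraMap ℝ ℂ), Polynomial.eval_map]
  exact Polynomial.eval₂_at_apply (algebraMap ℝ ℂ) t

/-- The η̄ and η coefficients are block off-diagonal and have no diagonal entries. The η̄η
coefficient comes from the scalars of `Vplus_commutator`, with the factor 1/2 of the exponential and
the sign of the supertrace. -/
theorem superCharacter_eq (a : ℕ) (g : SU2) {t : ℝ} (ht : g.1 0 0 + g.1 1 1 = (t : ℂ)) :
    superCharacter a g = (((charBody a).eval t : ℝ) : ℂ) • (1 : Grassmann)
      + (((charSoul a).eval t : ℝ) : ℂ) • (etaBar * eta) := by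
  have h1 := trace_wignerD (a + 1) g
  have h2 := trace_wignerD a g
  rw [ht, eval_chebyshev_ofReal] at h1 h2
  rw [show ((a + 1 : ℕ) : ℤ) - 1 = a by push_cast; ring] at h1
  have hs : superCharacter a g = ∑ i : Idx a, sgn ((irrep a).parity i) • (irrep a).mat g i i := rfl
  have hE : ∀ k : Fin (a + 1), sgn ((irrep a).parity (Sum.inl k)) = 1 := fun _ => sgn_zero
  have hO : ∀ r : Fin a, sgn ((irrep a).parity (Sum.inr r)) = -1 := fun _ => sgn_one
  set D : Matrix (Idx a) (Idx a) ℂ := fromBlocks (wignerD (a + 1) g) 0 0 (wignerD a g) with hD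
  have hp : ∀ i, (D * Vplus a) i i = 0 := by
    intro i
    rw [hD, Vplus_eq, fromBlocks_multiply]
    rcases i with i | i <;> simp
  have hm : ∀ i, (D * Vminus a) i i = 0 := by
    intro i
    rw [hD, Vminus_eq, fromBlocks_multiply]
    rcases i with i | i <;> simp
  have hc : D * (Vplus a * Vminus a - Vminus a * Vplus a)
      = fromBlocks ((-(a : ℂ) / 4) • wignerD (a + 1) g) 0 0
          ((((a : ℂ) + 1) / 4) • wignerD a g) := by
    rw [Vplus_commutator, hD, fromBlocks_multiply]
    congr 1 <;> ext i k <;> simp [Matrix.mul_diagonal, mul_comm]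
  have hmat : ∀ i : Idx a, (irrep a).mat g i i = D i i • (1 : Grassmann)
      + ((1 / 2 : ℂ) * (D * (Vplus a * Vminus a - Vminus a * Vplus a)) i i)
        • (etaBar * eta) := by
    intro i
    have h := congrFun (congrFun (irrep_mat a g D rfl) i) i
    refine h.trans ?_
    show D i i • (1 : Grassmann) + (D * Vplus a) i i • etaBar + (D * Vminus a) i i • eta
      + ((1 / 2 : ℂ) * (D * (Vplus a * Vminus a - Vminus a * Vplus a)) i i) • (etaBar * eta) = _
    rw [hp, hm, zero_smul, zero_smul, add_zero, add_zero]
  rw [hs, Fintype.sum_sum_type]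
  simp only [hE, hO, hmat, hc]
  simp only [hD, fromBlocks_apply₁₁, fromBlocks_apply₂₂, Matrix.smul_apply,
    smul_eq_mul, one_smul, neg_smul, Finset.sum_neg_distrib, Finset.sum_add_distrib,
    ← Finset.sum_smul, ← Finset.mul_sum]
  have h1' : ∑ i, wignerD (a + 1) g i i
      = ((Polynomial.eval t (Polynomial.Chebyshev.S ℝ a) : ℝ) : ℂ) := h1
  have h2' : ∑ i, wignerD a g i i
      = ((Polynomial.eval t (Polynomial.Chebyshev.S ℝ ((a : ℤ) - 1)) : ℝ) : ℂ) := h2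
  rw [h1', h2']
  simp only [charBody, charSoul, Polynomial.eval_sub, Polynomial.eval_mul, Polynomial.eval_add,
    Polynomial.eval_C]
  push_cast
  module

/-! ### Products of super characters -/

/-- The embedding of the dual numbers into the Grassmann algebra by `ε ↦ η̄ η`. -/
def dualHom : DualNumber ℂ →ₐ[ℂ] Grassmann :=
  DualNumber.lift ⟨(Algebra.ofId ℂ Grassmann, etaBar * eta), by
    have e3 : eta * (etaBar * eta) = 0 := by
      rw [← mul_assoc, eta_mul_etaBar, neg_mul, mul_assoc, eta_mul_self, mul_zero, neg_zero]
    show etaBar * eta * (etaBar * eta) = 0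
    rw [mul_assoc, e3, mul_zero],
    fun x => (Algebra.commutes x (etaBar * eta)).symm⟩

theorem dualHom_apply (x : DualNumber ℂ) :
    dualHom x = x.fst • (1 : Grassmann) + x.snd • (etaBar * eta) := by
  rw [dualHom, DualNumber.lift_apply_apply]
  show algebraMap ℂ Grassmann x.fst + algebraMap ℂ Grassmann x.snd * (etaBar * eta) = _
  rw [Algebra.algebraMap_eq_smul_one, Algebra.algebraMap_eq_smul_one, smul_one_mul]

/-- The ε-part of a dual number behaves as a derivative, so this is the Leibniz rule. The factor `n
l` makes the truncated exponent harmless at zero. -/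
theorem snd_prod_pow {ι : Type*} [DecidableEq ι] (s : Finset ι) (x : ι → DualNumber ℂ)
    (n : ι → ℕ) :
    (∏ l ∈ s, x l ^ n l).fst = ∏ l ∈ s, (x l).fst ^ n l ∧
    (∏ l ∈ s, x l ^ n l).snd = ∑ l ∈ s, (n l : ℂ) * (x l).snd * (x l).fst ^ (n l - 1)
      * ∏ i ∈ s.erase l, (x i).fst ^ n i := by
  induction s using Finset.induction_on with
  | empty => simp
  | insert b s hb ih =>
    rw [Finset.prod_insert hb, Finset.prod_insert hb, Finset.sum_insert hb, Finset.erase_insert hb]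
    refine ⟨by rw [TrivSqZeroExt.fst_mul, TrivSqZeroExt.fst_pow, ih.1], ?_⟩
    rw [TrivSqZeroExt.snd_mul, ih.1, ih.2, TrivSqZeroExt.snd_pow, TrivSqZeroExt.fst_pow,
      add_comm]
    congr 1
    · simp only [MulOpposite.smul_eq_mul_unop, MulOpposite.unop_op, smul_eq_mul, nsmul_eq_mul,
        Nat.pred_eq_sub_one]
      ring
    · rw [smul_eq_mul, Finset.mul_sum]
      refine Finset.sum_congr rfl fun l hl => ?_
      have hbl : b ≠ l := fun h => hb (h ▸ hl)
      rw [Finset.erase_insert_of_ne hbl, Finset.prod_insert fun h => hb (Finset.mem_of_mem_erase h)]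
      ring

/-- The body of the product of super characters, as a polynomial in the trace. -/
def prodBody {p : ℕ} (a n : Fin p → ℕ) : Polynomial ℝ := ∏ l, charBody (a l) ^ n l

/-- The coefficient of `η̄ η` of the product of super characters, as a polynomial in the trace. -/
def prodSoul {p : ℕ} (a n : Fin p → ℕ) : Polynomial ℝ :=
  ∑ l, Polynomial.C (n l : ℝ) * charSoul (a l) * charBody (a l) ^ (n l - 1)
    * ∏ i ∈ Finset.univ.erase l, charBody (a i) ^ n i

/-- All super characters lie in the image of the commutative dual numbers, so the ordered product
can be computed there. -/
theorem characterProduct_eq {p : ℕ} (a n : Fin p → ℕ) (g : SU2) {t : ℝ}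
    (ht : g.1 0 0 + g.1 1 1 = (t : ℂ)) :
    characterProduct a n g = (((prodBody a n).eval t : ℝ) : ℂ) • (1 : Grassmann)
      + (((prodSoul a n).eval t : ℝ) : ℂ) • (etaBar * eta) := by
  set x : Fin p → DualNumber ℂ := fun l =>
    TrivSqZeroExt.inl (((charBody (a l)).eval t : ℝ) : ℂ)
      + TrivSqZeroExt.inr (((charSoul (a l)).eval t : ℝ) : ℂ) with hx
  have hf : ∀ l, (x l).fst = (((charBody (a l)).eval t : ℝ) : ℂ) := fun l => by
    rw [hx, TrivSqZeroExt.fst_add, TrivSqZeroExt.fst_inl, TrivSqZeroExt.fst_inr, add_zero]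
  have hs : ∀ l, (x l).snd = (((charSoul (a l)).eval t : ℝ) : ℂ) := fun l => by
    rw [hx, TrivSqZeroExt.snd_add, TrivSqZeroExt.snd_inl, TrivSqZeroExt.snd_inr, zero_add]
  have hc : ∀ l, superCharacter (a l) g = dualHom (x l) := by
    intro l
    rw [superCharacter_eq (a l) g ht, dualHom_apply, hf, hs]
  have h1 : characterProduct a n g = dualHom (∏ l, x l ^ n l) := by
    have h2 : characterProduct a n g
        = Pi.evalMonoidHom (fun _ : SU2 => Grassmann) g (characterProduct a n) := rfl
    rw [h2, characterProduct, map_list_prod, ← List.prod_ofFn, map_list_prod, List.map_ofFn,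
      List.map_ofFn]
    congr 2
    funext l
    simp [hc]
  obtain ⟨e1, e2⟩ := snd_prod_pow Finset.univ x n
  rw [h1, dualHom_apply, e1, e2]
  simp only [hf, hs, prodBody, prodSoul, Polynomial.eval_prod, Polynomial.eval_pow,
    Polynomial.eval_finsetSum, Polynomial.eval_mul, Polynomial.eval_C]
  push_cast
  rfl

/-! ### The Berezin integral and traces in Euler angles -/

theorem berezin_smul_add (x y : ℂ) :
    berezin ((1 - (1 / 4 : ℂ) • (etaBar * eta)) * (x • (1 : Grassmann) + y • (etaBar * eta)))
      = x / 4 - y := by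
  have h : (1 - (1 / 4 : ℂ) • (etaBar * eta)) * (x • (1 : Grassmann) + y • (etaBar * eta))
      = x • 1 + (y - x / 4) • (etaBar * eta) := by
    have e3 : eta * (etaBar * eta) = 0 := by
      rw [← mul_assoc, eta_mul_etaBar, neg_mul, mul_assoc, eta_mul_self, mul_zero, neg_zero]
    have e5 : etaBar * eta * (etaBar * eta) = 0 := by rw [mul_assoc, e3, mul_zero]
    rw [sub_mul, one_mul, mul_add, smul_mul_smul_comm, smul_mul_smul_comm, e5, mul_one, smul_zero]
    module
  rw [h, berezin, LinearMap.neg_apply, map_add, map_smul, map_smul, topCoeff_one,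
    topCoeff_etaBar_mul_eta]
  simp

theorem trace_euler (φ ϑ ψ : ℝ) : (euler φ ϑ ψ).1 0 0 + (euler φ ϑ ψ).1 1 1
    = ((2 * Real.cos (ϑ / 2) * Real.cos ((φ + ψ) / 2) : ℝ) : ℂ) := by
  have h1 : Complex.exp (-(φ / 2 : ℝ) * Complex.I) * Complex.exp (-(ψ / 2 : ℝ) * Complex.I)
      = Complex.exp (-(((φ + ψ) / 2 : ℝ) : ℂ) * Complex.I) := by
    rw [← Complex.exp_add]; congr 1; push_cast; ring
  have h2 : Complex.exp ((φ / 2 : ℝ) * Complex.I) * Complex.exp ((ψ / 2 : ℝ) * Complex.I)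
      = Complex.exp ((((φ + ψ) / 2 : ℝ) : ℂ) * Complex.I) := by
    rw [← Complex.exp_add]; congr 1; push_cast; ring
  have h3 := Complex.two_cos (((φ + ψ) / 2 : ℝ) : ℂ)
  have e0 : (euler φ ϑ ψ).1 0 0 = Complex.exp (-(φ / 2 : ℝ) * Complex.I) * Real.cos (ϑ / 2)
      * Complex.exp (-(ψ / 2 : ℝ) * Complex.I) := by
    simp [euler, eulerMatrix]
  have e1 : (euler φ ϑ ψ).1 1 1 = Complex.exp ((φ / 2 : ℝ) * Complex.I) * Real.cos (ϑ / 2)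
      * Complex.exp ((ψ / 2 : ℝ) * Complex.I) := by
    simp [euler, eulerMatrix]
  rw [e0, e1, Complex.ofReal_mul, Complex.ofReal_mul, Complex.ofReal_cos ((φ + ψ) / 2),
    Complex.ofReal_ofNat]
  linear_combination (Real.cos (ϑ / 2) : ℂ) * h1 + (Real.cos (ϑ / 2) : ℂ) * h2
    - (Real.cos (ϑ / 2) : ℂ) * h3

theorem exists_trace_eq (g : SU2) : ∃ t : ℝ, g.1 0 0 + g.1 1 1 = (t : ℂ) := by
  obtain ⟨x, y, z, rfl⟩ := exists_euler g
  have h := trace_euler (2 * x) (2 * y) (2 * z)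
  rw [euler_eq, mul_div_cancel_left₀ x two_ne_zero, mul_div_cancel_left₀ y two_ne_zero,
    mul_div_cancel_left₀ z two_ne_zero] at h
  exact ⟨_, h⟩

theorem superCharacter_zero (g : SU2) : superCharacter 0 g = 1 := by
  obtain ⟨t, ht⟩ := exists_trace_eq g
  rw [superCharacter_eq 0 g ht]
  simp [charBody, charSoul]

theorem superScalar_superCharacter_zero (f : SuperFunction) :
    superScalar (superCharacter 0) f = integral f := by
  simp only [superScalar, superCharacter_zero, conj_one, one_mul]

/-! ### Class functions on `SU(2)` -/

theorem integral_cos_pow_add_two (m : ℕ) :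
    ∫ x in (0 : ℝ)..2 * π, Real.cos x ^ (m + 2)
      = ((m : ℝ) + 1) / (m + 2) * ∫ x in (0 : ℝ)..2 * π, Real.cos x ^ m := by
  rw [integral_cos_pow]
  simp

theorem integral_sin_mul_cos_half_pow (m : ℕ) :
    ∫ ϑ in (0 : ℝ)..π, Real.sin ϑ * (2 * Real.cos (ϑ / 2)) ^ m = 4 * 2 ^ m / ((m : ℝ) + 2) := by
  -- Since sin ϑ = 2 sin(ϑ/2) cos(ϑ/2), a power of cos(ϑ/2) is a primitive.
  have hd : ∀ ϑ ∈ Set.uIcc 0 π, HasDerivAt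
      (fun ϑ => -(4 * 2 ^ m / ((m : ℝ) + 2)) * Real.cos (ϑ / 2) ^ (m + 2))
      (Real.sin ϑ * (2 * Real.cos (ϑ / 2)) ^ m) ϑ := by
    intro ϑ _
    have h1 : HasDerivAt (fun ϑ : ℝ => ϑ / 2) (1 / 2) ϑ := (hasDerivAt_id ϑ).div_const 2
    have h := ((h1.cos).pow (m + 2)).const_mul (-(4 * 2 ^ m / ((m : ℝ) + 2)))
    convert! h using 1
    have h2 : Real.sin ϑ = 2 * Real.sin (ϑ / 2) * Real.cos (ϑ / 2) := by
      rw [← Real.sin_two_mul]; congr 1; ring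
    have h3 : (m : ℝ) + 2 ≠ 0 := by positivity
    rw [h2, show m + 2 - 1 = m + 1 by omega]
    push_cast
    field_simp
    ring
  rw [intervalIntegral.integral_eq_sub_of_hasDerivAt hd
    (Continuous.intervalIntegrable (by fun_prop) _ _)]
  simp

theorem integral_sin_sq_mul_pow (m : ℕ) :
    ∫ θ in (0 : ℝ)..π, Real.sin (2 * θ) ^ 2 * (2 * Real.cos (2 * θ)) ^ m
      = 2 ^ m / (2 * ((m : ℝ) + 2)) * ∫ x in (0 : ℝ)..2 * π, Real.cos x ^ m := by
  rw [intervalIntegral.integral_comp_mul_left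
    (fun x => Real.sin x ^ 2 * (2 * Real.cos x) ^ m) two_ne_zero]
  have h1 : ∀ x, Real.sin x ^ 2 * (2 * Real.cos x) ^ m
      = 2 ^ m * (Real.cos x ^ m - Real.cos x ^ (m + 2)) := by
    intro x
    rw [Real.sin_sq]
    ring
  simp only [h1]
  rw [intervalIntegral.integral_const_mul, intervalIntegral.integral_sub
    (Continuous.intervalIntegrable (by fun_prop) _ _)
    (Continuous.intervalIntegrable (by fun_prop) _ _), mul_zero, integral_cos_pow_add_two,
    smul_eq_mul]
  have h3 : (m : ℝ) + 2 ≠ 0 := by positivity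
  field_simp
  ring

/-- As ψ runs over 4π the half-angle runs over one full period, so periodicity removes φ and the
substitution gives the factor 2. -/
theorem integral_euler_angle (p : Polynomial ℝ) (c s φ : ℝ) :
    ∫ ψ in (0 : ℝ)..(4 * π), s * p.eval (2 * c * Real.cos ((φ + ψ) / 2))
      = 2 * ∫ x in (0 : ℝ)..2 * π, s * p.eval (2 * c * Real.cos x) := by
  set f : ℝ → ℝ := fun x => s * p.eval (2 * c * Real.cos x) with hf
  have hper : Function.Periodic f (2 * π) := by
    intro x
    simp only [hf, Real.cos_add_two_pi]
  have h1 : ∀ ψ, s * p.eval (2 * c * Real.cos ((φ + ψ) / 2)) = f (ψ / 2 + φ / 2) := by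
    intro ψ
    simp only [hf]
    congr 4
    ring
  simp only [h1]
  rw [intervalIntegral.integral_comp_div_add f two_ne_zero, smul_eq_mul]
  congr 1
  have h2 := hper.intervalIntegral_add_eq (φ / 2) 0
  rw [zero_add] at h2
  rw [← h2]
  congr 1 <;> ring

/-- By linearity it suffices to compare monomials; both sides reduce to the same multiple of ∫ cosⁱ
over a period. -/
theorem integral_trace (p : Polynomial ℝ) :
    ∫ ϑ in (0 : ℝ)..π, ∫ x in (0 : ℝ)..2 * π,
        Real.sin ϑ * p.eval (2 * Real.cos (ϑ / 2) * Real.cos x)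
      = 8 * ∫ θ in (0 : ℝ)..π, Real.sin (2 * θ) ^ 2 * p.eval (2 * Real.cos (2 * θ)) := by
  simp only [Polynomial.eval_eq_sum_range, Finset.mul_sum]
  have h1 : ∀ ϑ : ℝ, ∫ x in (0 : ℝ)..2 * π, ∑ i ∈ Finset.range (p.natDegree + 1),
      Real.sin ϑ * (p.coeff i * (2 * Real.cos (ϑ / 2) * Real.cos x) ^ i)
      = ∑ i ∈ Finset.range (p.natDegree + 1),
        (p.coeff i * ∫ x in (0 : ℝ)..2 * π, Real.cos x ^ i)
          * (Real.sin ϑ * (2 * Real.cos (ϑ / 2)) ^ i) := by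
    intro ϑ
    rw [intervalIntegral.integral_finsetSum fun i _ =>
      Continuous.intervalIntegrable (by fun_prop) _ _]
    refine Finset.sum_congr rfl fun i _ => ?_
    rw [mul_right_comm, mul_comm, ← mul_assoc, ← intervalIntegral.integral_const_mul]
    congr 1
    ext x
    ring
  simp only [h1]
  rw [intervalIntegral.integral_finsetSum fun i _ =>
      Continuous.intervalIntegrable (by fun_prop) _ _,
    intervalIntegral.integral_finsetSum fun i _ =>
      Continuous.intervalIntegrable (by fun_prop) _ _, Finset.mul_sum]
  refine Finset.sum_congr rfl fun i _ => ?_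
  have h2 : ∀ θ : ℝ, Real.sin (2 * θ) ^ 2 * (p.coeff i * (2 * Real.cos (2 * θ)) ^ i)
      = p.coeff i * (Real.sin (2 * θ) ^ 2 * (2 * Real.cos (2 * θ)) ^ i) := fun θ => by ring
  simp only [h2]
  rw [intervalIntegral.integral_const_mul, intervalIntegral.integral_const_mul,
    integral_sin_mul_cos_half_pow, integral_sin_sq_mul_pow]
  have h3 : (i : ℝ) + 2 ≠ 0 := by positivity
  field_simp
  ring

/-- The Weyl integration formula for polynomials in the trace. -/
theorem integralSU2_eq (p : Polynomial ℝ) {F : SU2 → ℂ}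
    (hF : ∀ g (t : ℝ), g.1 0 0 + g.1 1 1 = (t : ℂ) → F g = (p.eval t : ℝ)) :
    integralSU2 F = ((8 / π * ∫ θ in (0 : ℝ)..π,
      Real.sin (2 * θ) ^ 2 * p.eval (2 * Real.cos (2 * θ)) : ℝ) : ℂ) := by
  have hF' : ∀ φ ϑ ψ, F (euler φ ϑ ψ)
      = (p.eval (2 * Real.cos (ϑ / 2) * Real.cos ((φ + ψ) / 2)) : ℝ) :=
    fun φ ϑ ψ => hF _ _ (trace_euler φ ϑ ψ)
  rw [integralSU2]
  simp only [hF', ← Complex.ofReal_mul, intervalIntegral.integral_ofReal, integral_euler_angle,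
    intervalIntegral.integral_const_mul (2 : ℝ)]
  -- The constants combine to (4π²)⁻¹ · 2π · 2 · 8 = 8/π.
  simp only [integral_trace, intervalIntegral.integral_const, sub_zero, smul_eq_mul]
  have hpi : (π : ℂ) ≠ 0 := by exact_mod_cast Real.pi_ne_zero
  push_cast
  field_simp
  ring

/-! ### The trigonometric integrals -/

/-- The body of the super character on the torus. -/
def torusBody (a : ℕ) (θ : ℝ) : ℝ := (charBody a).eval (2 * Real.cos (2 * θ))

/-- The ungraded character on the torus. -/
def torusSum (a : ℕ) (θ : ℝ) : ℝ :=
  (Polynomial.Chebyshev.S ℝ a + Polynomial.Chebyshev.S ℝ ((a : ℤ) - 1)).eval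
    (2 * Real.cos (2 * θ))

@[fun_prop]
theorem continuous_torusBody (a : ℕ) : Continuous (torusBody a) := by
  unfold torusBody; fun_prop

@[fun_prop]
theorem continuous_torusSum (a : ℕ) : Continuous (torusSum a) := by
  unfold torusSum; fun_prop

/-- Both sides obey the three-term recursion in a with multiplier 2 cos 2θ. The product form stays
valid at the zeros of cos θ. -/
theorem cos_mul_torusBody (a : ℕ) (θ : ℝ) :
    Real.cos θ * torusBody a θ = Real.cos (dimRep a * θ) := by
  have key : ∀ a : ℕ, Real.cos θ * torusBody a θ = Real.cos (dimRep a * θ) ∧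
      Real.cos θ * torusBody (a + 1) θ = Real.cos (dimRep (a + 1) * θ) := by
    intro a
    induction a with
    | zero =>
      constructor
      · simp [torusBody, charBody, dimRep]
      · have h : dimRep (0 + 1) * θ = 3 * θ := by simp only [dimRep]; push_cast; ring
        rw [h, Real.cos_three_mul]
        simp [torusBody, charBody, Real.cos_two_mul]
        ring
    | succ a ih =>
      refine ⟨ih.2, ?_⟩
      have h1 : torusBody (a + 1 + 1) θ
          = 2 * Real.cos (2 * θ) * torusBody (a + 1) θ - torusBody a θ := by
        have e1 := Polynomial.Chebyshev.S_add_two ℝ (a : ℤ)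
        have e2 := Polynomial.Chebyshev.S_add_one ℝ (a : ℤ)
        simp only [torusBody, charBody]
        push_cast
        rw [show (a : ℤ) + 1 + 1 - 1 = a + 1 by ring, show (a : ℤ) + 1 + 1 = a + 2 by ring,
          show (a : ℤ) + 1 - 1 = a by ring, e1, e2]
        simp only [Polynomial.eval_sub, Polynomial.eval_mul, Polynomial.eval_X]
        ring
      have h2 : dimRep (a + 1 + 1) * θ = dimRep (a + 1) * θ + 2 * θ := by
        simp only [dimRep]; push_cast; ring
      have h3 : dimRep a * θ = dimRep (a + 1) * θ - 2 * θ := by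
        simp only [dimRep]; push_cast; ring
      have ih1 := ih.1
      rw [h3, Real.cos_sub] at ih1
      rw [h1, h2, Real.cos_add]
      linear_combination 2 * Real.cos (2 * θ) * ih.2 - ih1
  exact (key a).1

theorem sin_mul_torusSum (a : ℕ) (θ : ℝ) :
    Real.sin θ * torusSum a θ = Real.sin (dimRep a * θ) := by
  have key : ∀ a : ℕ, Real.sin θ * torusSum a θ = Real.sin (dimRep a * θ) ∧
      Real.sin θ * torusSum (a + 1) θ = Real.sin (dimRep (a + 1) * θ) := by
    intro a
    induction a with
    | zero =>
      constructor
      · simp [torusSum, dimRep]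
      · have h : dimRep (0 + 1) * θ = 3 * θ := by simp only [dimRep]; push_cast; ring
        rw [h, Real.sin_three_mul]
        simp [torusSum, Real.cos_two_mul, Real.cos_sq']
        ring
    | succ a ih =>
      refine ⟨ih.2, ?_⟩
      have h1 : torusSum (a + 1 + 1) θ
          = 2 * Real.cos (2 * θ) * torusSum (a + 1) θ - torusSum a θ := by
        have e1 := Polynomial.Chebyshev.S_add_two ℝ (a : ℤ)
        have e2 := Polynomial.Chebyshev.S_add_one ℝ (a : ℤ)
        simp only [torusSum]
        push_cast
        rw [show (a : ℤ) + 1 + 1 - 1 = a + 1 by ring, show (a : ℤ) + 1 + 1 = a + 2 by ring,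
          show (a : ℤ) + 1 - 1 = a by ring, e1, e2]
        simp only [Polynomial.eval_sub, Polynomial.eval_add, Polynomial.eval_mul,
          Polynomial.eval_X]
        ring
      have h2 : dimRep (a + 1 + 1) * θ = dimRep (a + 1) * θ + 2 * θ := by
        simp only [dimRep]; push_cast; ring
      have h3 : dimRep a * θ = dimRep (a + 1) * θ - 2 * θ := by
        simp only [dimRep]; push_cast; ring
      have ih1 := ih.1
      rw [h3, Real.sin_sub] at ih1
      rw [h1, h2, Real.sin_add]
      linear_combination 2 * Real.cos (2 * θ) * ih.2 - ih1
  exact (key a).1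

/-- Differentiate cos θ · B = cos(dθ). The derivative is specified only after multiplication by cos
θ, which is enough for the primitive used later and avoids dividing at the zeros of cos θ. -/
theorem hasDerivAt_torusBody (a : ℕ) (θ : ℝ) :
    ∃ β, HasDerivAt (torusBody a) β θ ∧
      Real.cos θ * β = -Real.sin θ * (dimRep a * torusSum a θ - torusBody a θ) := by
  have hd : DifferentiableAt ℝ (torusBody a) θ := by
    unfold torusBody
    have h1 : DifferentiableAt ℝ (fun θ : ℝ => 2 * Real.cos (2 * θ)) θ := by fun_prop
    exact (charBody a).differentiable.differentiableAt.comp θ h1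
  refine ⟨_, hd.hasDerivAt, ?_⟩
  have h1 := (Real.hasDerivAt_cos θ).mul hd.hasDerivAt
  have h2 : HasDerivAt (fun θ => Real.cos (dimRep a * θ))
      (-Real.sin (dimRep a * θ) * (dimRep a * 1)) θ :=
    ((hasDerivAt_id θ).const_mul (dimRep a)).cos
  have h3 : (Real.cos * torusBody a) = fun θ => Real.cos (dimRep a * θ) :=
    funext fun θ => cos_mul_torusBody a θ
  rw [h3] at h1
  have h4 := h1.unique h2
  rw [← sin_mul_torusSum] at h4
  linear_combination h4

/-- Together with `hasDerivAt_torusBody` this says cos θ · B' = 16 sin θ · S, the link between soul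
and body. -/
theorem eval_charSoul (a : ℕ) (θ : ℝ) : (charSoul a).eval (2 * Real.cos (2 * θ))
    = -(1 / 16) * (dimRep a * torusSum a θ - torusBody a θ) := by
  simp only [charSoul, torusSum, torusBody, charBody, dimRep, Polynomial.eval_mul,
    Polynomial.eval_add, Polynomial.eval_sub, Polynomial.eval_C]
  ring

section Products

variable {p : ℕ} (a n : Fin p → ℕ)

/-- The body of the product of the super characters on the torus. -/
def torusProd (θ : ℝ) : ℝ := ∏ l, torusBody (a l) θ ^ n l

/-- The product of super characters with one factor of index `l` removed. -/
def torusRest (l : Fin p) (θ : ℝ) : ℝ :=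
  torusBody (a l) θ ^ (n l - 1) * ∏ i ∈ Finset.univ.erase l, torusBody (a i) θ ^ n i

theorem eval_prodBody (θ : ℝ) :
    (prodBody a n).eval (2 * Real.cos (2 * θ)) = torusProd a n θ := by
  simp only [prodBody, torusProd, torusBody, Polynomial.eval_prod, Polynomial.eval_pow]

theorem mul_torusRest (l : Fin p) (θ : ℝ) :
    (n l : ℝ) * torusBody (a l) θ * torusRest a n l θ = n l * torusProd a n θ := by
  rw [torusRest, torusProd, ← Finset.mul_prod_erase _ _ (Finset.mem_univ l)]
  rcases hn : n l with _ | m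
  · simp
  · rw [Nat.add_sub_cancel, pow_succ]
    ring

theorem eval_prodSoul (θ : ℝ) : (prodSoul a n).eval (2 * Real.cos (2 * θ))
    = ∑ l, (n l : ℝ) * (-(1 / 16) * (dimRep (a l) * torusSum (a l) θ - torusBody (a l) θ))
        * torusRest a n l θ := by
  simp only [prodSoul, Polynomial.eval_finsetSum, Polynomial.eval_mul, Polynomial.eval_C,
    Polynomial.eval_pow, Polynomial.eval_prod, eval_charSoul, torusRest]
  refine Finset.sum_congr rfl fun l _ => ?_
  simp only [torusBody]
  ring

/-- Where sin 2θ = 0 both sides vanish, so the value of a division by zero is irrelevant; elsewhere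
cos θ cancels. The integrand is therefore continuous. -/
theorem mainIntegrand_eq (θ : ℝ) :
    mainIntegrand a n θ = Real.sin (2 * θ) ^ 2 * torusProd a n θ := by
  by_cases h : Real.sin (2 * θ) = 0
  · simp [mainIntegrand, h]
  · have hc : Real.cos θ ≠ 0 := fun hc => h (by rw [Real.sin_two_mul, hc, mul_zero])
    simp only [mainIntegrand, torusProd, ← cos_mul_torusBody, mul_div_cancel_left₀ _ hc]

theorem correctionIntegrand_eq (l : Fin p) (θ : ℝ) :
    correctionIntegrand a n l θ
      = Real.sin (2 * θ) ^ 2 * (torusSum (a l) θ * torusRest a n l θ) := by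
  by_cases h : Real.sin (2 * θ) = 0
  · simp [correctionIntegrand, h]
  · have hc : Real.cos θ ≠ 0 := fun hc => h (by rw [Real.sin_two_mul, hc, mul_zero])
    have hs : Real.sin θ ≠ 0 := fun hs => h (by rw [Real.sin_two_mul, hs, mul_zero, zero_mul])
    simp only [correctionIntegrand, torusRest, ← cos_mul_torusBody, ← sin_mul_torusSum,
      mul_div_cancel_left₀ _ hc, mul_div_cancel_left₀ _ hs]
    ring

@[fun_prop]
theorem continuous_torusProd : Continuous (torusProd a n) := by
  unfold torusProd; fun_prop

@[fun_prop]
theorem continuous_torusRest (l : Fin p) : Continuous (torusRest a n l) := by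
  unfold torusRest; fun_prop

theorem continuous_mainIntegrand : Continuous (mainIntegrand a n) := by
  rw [funext (mainIntegrand_eq a n)]
  fun_prop

theorem continuous_correctionIntegrand (l : Fin p) : Continuous (correctionIntegrand a n l) := by
  rw [funext (correctionIntegrand_eq a n l)]
  fun_prop

/-- The polynomial in the trace that is integrated over `SU(2)`. -/
def integrandPoly : Polynomial ℝ := Polynomial.C (1 / 4 : ℝ) * prodBody a n - prodSoul a n

theorem integral_characterProduct : integral (characterProduct a n)
    = ((8 / π * ∫ θ in (0 : ℝ)..π, Real.sin (2 * θ) ^ 2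
        * (integrandPoly a n).eval (2 * Real.cos (2 * θ)) : ℝ) : ℂ) := by
  rw [integral, integralSU2_eq (integrandPoly a n)]
  intro g t ht
  rw [characterProduct_eq a n g ht, berezin_smul_add]
  simp only [integrandPoly, Polynomial.eval_sub, Polynomial.eval_mul, Polynomial.eval_C]
  push_cast
  ring

theorem integral_eq_verlindeIntegral :
    8 / π * ∫ θ in (0 : ℝ)..π, Real.sin (2 * θ) ^ 2
        * (integrandPoly a n).eval (2 * Real.cos (2 * θ)) = verlindeIntegral a n := by
  have h1 : ∀ θ, Real.sin (2 * θ) ^ 2 * (integrandPoly a n).eval (2 * Real.cos (2 * θ))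
      = (1 - (∑ l, (n l : ℝ)) / 4) / 4 * mainIntegrand a n θ
        + ∑ l, 1 / 16 * ((n l : ℝ) * dimRep (a l)) * correctionIntegrand a n l θ := by
    intro θ
    -- The body terms of the soul recombine to (n/16)P; subtracted from P/4 they give the factor 1 -
    -- n/4.
    have h2 : (prodSoul a n).eval (2 * Real.cos (2 * θ))
        = 1 / 16 * (∑ l, (n l : ℝ)) * torusProd a n θ
          - ∑ l, 1 / 16 * ((n l : ℝ) * dimRep (a l)) * (torusSum (a l) θ * torusRest a n l θ) := by
      rw [eval_prodSoul, mul_assoc, Finset.sum_mul, Finset.mul_sum, ← Finset.sum_sub_distrib]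
      refine Finset.sum_congr rfl fun l _ => ?_
      linear_combination (1 / 16) * mul_torusRest a n l θ
    simp only [integrandPoly, Polynomial.eval_sub, Polynomial.eval_mul, Polynomial.eval_C,
      eval_prodBody, h2, mainIntegrand_eq, correctionIntegrand_eq, mul_left_comm _ (Real.sin _ ^ 2),
      ← Finset.mul_sum]
    ring
  simp only [h1]
  rw [intervalIntegral.integral_add, intervalIntegral.integral_const_mul,
    intervalIntegral.integral_finsetSum]
  · simp only [intervalIntegral.integral_const_mul]
    have h3 : ∀ l, 1 / 16 * ((n l : ℝ) * dimRep (a l))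
        * ∫ θ in (0 : ℝ)..π, correctionIntegrand a n l θ
        = 1 / 16 * ((n l : ℝ) * dimRep (a l)
          * ∫ θ in (0 : ℝ)..π, correctionIntegrand a n l θ) := fun l => by ring
    simp only [h3, ← Finset.mul_sum]
    rw [verlindeIntegral]
    have := Real.pi_ne_zero
    field_simp
    ring
  · exact fun l _ => ((continuous_correctionIntegrand a n l).const_mul _).intervalIntegrable _ _
  · exact ((continuous_mainIntegrand a n).const_mul _).intervalIntegrable _ _
  · exact (continuous_finsetSum _ fun l _ =>
      (continuous_correctionIntegrand a n l).const_mul _).intervalIntegrable _ _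

theorem hasDerivAt_torusProd (θ : ℝ) : ∃ P', HasDerivAt (torusProd a n) P' θ ∧
    Real.cos θ * P' = -Real.sin θ * ∑ l, (n l : ℝ)
      * (dimRep (a l) * torusSum (a l) θ - torusBody (a l) θ) * torusRest a n l θ := by
  choose β hβ hβ' using fun l => hasDerivAt_torusBody (a l) θ
  refine ⟨_, HasDerivAt.fun_finsetProd fun l _ => (hβ l).pow (n l), ?_⟩
  rw [Finset.mul_sum, Finset.mul_sum]
  refine Finset.sum_congr rfl fun l _ => ?_
  simp only [torusRest, smul_eq_mul]
  linear_combination (n l : ℝ) * torusBody (a l) θ ^ (n l - 1)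
    * (∏ i ∈ Finset.univ.erase l, torusBody (a i) θ ^ n i) * hβ' l

theorem integral_eq_integral_cos_sq :
    8 / π * ∫ θ in (0 : ℝ)..π, Real.sin (2 * θ) ^ 2
        * (integrandPoly a n).eval (2 * Real.cos (2 * θ))
      = 2 / π * ∫ θ in (0 : ℝ)..π, Real.cos θ ^ 2 * torusProd a n θ := by
  -- (sin θ cos³θ)' = cos²θ - sin²(2θ), while cos θ · P' = 16 sin θ · soul contributes 4 sin²(2θ) ·
  -- soul. The primitive vanishes at both endpoints.
  have hG : ∀ θ ∈ Set.uIcc 0 π, HasDerivAt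
      (fun θ => Real.sin θ * Real.cos θ ^ 3 * torusProd a n θ)
      (Real.cos θ ^ 2 * torusProd a n θ - 4 * (Real.sin (2 * θ) ^ 2
        * (integrandPoly a n).eval (2 * Real.cos (2 * θ)))) θ := by
    intro θ _
    obtain ⟨P', hP, hP'⟩ := hasDerivAt_torusProd a n θ
    have h := ((Real.hasDerivAt_sin θ).mul ((Real.hasDerivAt_cos θ).pow 3)).mul hP
    convert! h using 1
    have h2 : (prodSoul a n).eval (2 * Real.cos (2 * θ)) = -(1 / 16) * ∑ l, (n l : ℝ)
        * (dimRep (a l) * torusSum (a l) θ - torusBody (a l) θ) * torusRest a n l θ := by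
      rw [eval_prodSoul, Finset.mul_sum]
      exact Finset.sum_congr rfl fun l _ => by ring
    simp only [integrandPoly, Polynomial.eval_sub, Polynomial.eval_mul, Polynomial.eval_C,
      eval_prodBody, h2, Pi.mul_apply, Pi.pow_apply, Real.sin_two_mul]
    have h3 := Real.sin_sq_add_cos_sq θ
    push_cast
    linear_combination (-(Real.sin θ * Real.cos θ ^ 2)) * hP'
      - Real.cos θ ^ 2 * torusProd a n θ * h3
  have h0 := intervalIntegral.integral_eq_sub_of_hasDerivAt hG
    (Continuous.intervalIntegrable (by fun_prop) _ _)
  rw [intervalIntegral.integral_sub (Continuous.intervalIntegrable (by fun_prop) _ _)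
    (Continuous.intervalIntegrable (by fun_prop) _ _), intervalIntegral.integral_const_mul,
    Real.sin_pi, Real.sin_zero] at h0
  linear_combination (-2 / π) * h0

end Products

/-! ### Characters on the torus and weight multiplicities -/

namespace Realization

/-- The super character on the torus. -/
def torusChar {R : SuperMatrix} (r : Realization R) (θ : ℝ) : ℂ :=
  ∑ i, sgn (R.parity i) * Complex.exp (2 * (r.w i : ℂ) * Complex.I * θ)

theorem torusChar_tensor {R S : SuperMatrix} (r : Realization R) (q : Realization S) (θ : ℝ) :
    (r.tensor q).torusChar θ = r.torusChar θ * q.torusChar θ := by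
  rw [torusChar, torusChar, torusChar, Finset.sum_mul_sum, ← Finset.sum_product']
  refine Finset.sum_congr rfl fun i _ => ?_
  show sgn (R.parity i.1 + S.parity i.2)
    * Complex.exp (2 * ((r.w i.1 + q.w i.2 : ℤ) : ℂ) * Complex.I * θ) = _
  rw [sgn_add, mul_mul_mul_comm, ← Complex.exp_add]
  congr 2
  push_cast
  ring

theorem integral_exp_weight (w : ℤ) :
    ∫ θ in (0 : ℝ)..π, Complex.exp (2 * (w : ℂ) * Complex.I * θ) = if w = 0 then (π : ℂ) else 0 := by
  split_ifs with h
  · simp [h]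
  · have hw : (2 * (w : ℂ) * Complex.I) ≠ 0 := by simp [h]
    rw [integral_exp_mul_complex hw]
    have h1 : Complex.exp (2 * (w : ℂ) * Complex.I * (π : ℝ)) = 1 := by
      rw [show 2 * (w : ℂ) * Complex.I * (π : ℝ) = w * (2 * π * Complex.I) by ring]
      exact Complex.exp_int_mul_two_pi_mul_I w
    rw [h1]
    simp

/-- The factor 1 + exp(-2iθ) selects the weights 0 and 1; its real part is 2cos²θ. -/
theorem integral_torusChar {R : SuperMatrix} (r : Realization R) :
    ∫ θ in (0 : ℝ)..π, (1 + Complex.exp (-(2 * Complex.I * θ))) * r.torusChar θ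
      = π * (∑ i, sgn (R.parity i) * ((if r.w i = 0 then 1 else 0) + if r.w i = 1 then 1 else 0)) := by
  have h1 : ∀ θ : ℝ, (1 + Complex.exp (-(2 * Complex.I * θ))) * r.torusChar θ
      = ∑ i, sgn (R.parity i) * (Complex.exp (2 * (r.w i : ℂ) * Complex.I * θ)
        + Complex.exp (2 * ((r.w i - 1 : ℤ) : ℂ) * Complex.I * θ)) := by
    intro θ
    rw [torusChar, Finset.mul_sum]
    refine Finset.sum_congr rfl fun i _ => ?_
    rw [mul_left_comm, add_mul, one_mul, ← Complex.exp_add]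
    congr 3
    push_cast
    ring_nf
  simp only [h1]
  rw [intervalIntegral.integral_finsetSum fun i _ =>
    Continuous.intervalIntegrable (by fun_prop) _ _, Finset.mul_sum]
  refine Finset.sum_congr rfl fun i _ => ?_
  rw [intervalIntegral.integral_const_mul, intervalIntegral.integral_add
    (Continuous.intervalIntegrable (by fun_prop) _ _)
    (Continuous.intervalIntegrable (by fun_prop) _ _), integral_exp_weight, integral_exp_weight]
  simp only [sub_eq_zero]
  split_ifs <;> ring

/-- Parity flips with the weight, so weights 0 and 1 enter with opposite signs and the sum becomes
the difference in `numInvariants_add`. -/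
theorem sum_sgn_weight {R : SuperMatrix} (r : Realization R) {c : ZMod 2}
    (hc : ∀ i, R.parity i = r.w i + c) :
    ∑ i, sgn (R.parity i) * (((if r.w i = 0 then 1 else 0) : ℂ) + if r.w i = 1 then 1 else 0)
      = R.superNumInvariants := by
  have h := r.numInvariants_add
  have h' : (R.numInvariants : ℂ) = (Finset.univ.filter fun i => r.w i = 0).card
      - (Finset.univ.filter fun i => r.w i = 1).card := by
    rw [← h]; push_cast; ring
  rw [r.superNumInvariants_eq hc, h', Finset.card_filter, Finset.card_filter]
  push_cast
  rw [← Finset.sum_sub_distrib, Finset.mul_sum]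
  refine Finset.sum_congr rfl fun i _ => ?_
  rw [hc, sgn_add]
  by_cases h0 : r.w i = 0
  · simp [h0, sgn_zero]
  · by_cases h1 : r.w i = 1
    · simp [h1, sgn_one]
    · simp [h0, h1]

/-- The signed number of invariants as an integral of the real super character on the torus. -/
theorem superNumInvariants_eq_integral {R : SuperMatrix} (r : Realization R) {c : ZMod 2}
    (hc : ∀ i, R.parity i = r.w i + c) {f : ℝ → ℝ} (hfc : Continuous f)
    (hf : ∀ θ, r.torusChar θ = f θ) :
    (R.superNumInvariants : ℝ) = 2 / π * ∫ θ in (0 : ℝ)..π, Real.cos θ ^ 2 * f θ := by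
  have h := r.integral_torusChar
  rw [r.sum_sgn_weight hc] at h
  simp only [hf] at h
  -- As f is real, taking real parts replaces the complex factor by 2cos²θ.
  have h1 := congrArg Complex.re h
  have h2 := Complex.reCLM.intervalIntegral_comp_comm (μ := MeasureTheory.volume) (a := 0) (b := π)
    (f := fun θ : ℝ => (1 + Complex.exp (-(2 * Complex.I * θ))) * (f θ : ℂ))
    (Continuous.intervalIntegrable (by fun_prop) _ _)
  simp only [Complex.reCLM_apply] at h2
  rw [← h2, Complex.re_ofReal_mul, Complex.intCast_re] at h1
  have h3 : ∀ θ : ℝ, ((1 + Complex.exp (-(2 * Complex.I * θ))) * (f θ : ℂ)).re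
      = 2 * (Real.cos θ ^ 2 * f θ) := by
    intro θ
    have h4 : -(2 * Complex.I * (θ : ℂ)) = ((-(2 * θ) : ℝ) : ℂ) * Complex.I := by push_cast; ring
    rw [Complex.re_mul_ofReal, h4, Complex.add_re, Complex.exp_ofReal_mul_I_re, Real.cos_neg,
      Real.cos_two_mul, Complex.one_re]
    ring
  simp only [h3, intervalIntegral.integral_const_mul] at h1
  have := Real.pi_ne_zero
  field_simp
  linarith

end Realization

/-- The sum is the trace of a symmetric power of a diagonal matrix, so `sum_coeff_eq_chebyshev`
applies with zero off-diagonal entries. -/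
theorem sum_exp_eq_chebyshev (N : ℕ) (θ : ℝ) :
    ∑ k : Fin N, Complex.exp (2 * ((2 * (k : ℕ) + 1 - N : ℤ) : ℂ) * Complex.I * θ)
      = (((Polynomial.Chebyshev.S ℝ ((N : ℤ) - 1)).eval (2 * Real.cos (2 * θ)) : ℝ) : ℂ) := by
  rcases N with _ | n
  · simp
  · set α := Complex.exp (2 * Complex.I * θ) with hα
    set δ := Complex.exp (-(2 * Complex.I * θ)) with hδ
    have hdet : α * δ - 0 * 0 = 1 := by
      rw [hα, hδ, ← Complex.exp_add]
      simp
    have htr : α + δ = ((2 * Real.cos (2 * θ) : ℝ) : ℂ) := by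
      have h := Complex.two_cos ((2 * θ : ℝ) : ℂ)
      rw [Complex.ofReal_mul, Complex.ofReal_cos, Complex.ofReal_ofNat, h, hα, hδ]
      congr 2 <;> push_cast <;> ring
    have h := sum_coeff_eq_chebyshev hdet n
    rw [htr, eval_chebyshev_ofReal, Finset.Nat.sum_antidiagonal_eq_sum_range_succ_mk,
      Finset.sum_range] at h
    rw [show ((n + 1 : ℕ) : ℤ) - 1 = n by push_cast; ring, ← h]
    refine Finset.sum_congr rfl fun k _ => ?_
    have h1 : ((Polynomial.C α * Polynomial.X + Polynomial.C 0) ^ (k : ℕ)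
        * (Polynomial.C 0 * Polynomial.X + Polynomial.C δ) ^ (n - (k : ℕ))).coeff (k : ℕ)
        = α ^ (k : ℕ) * δ ^ (n - (k : ℕ)) := by
      rw [map_zero, zero_mul, zero_add, add_zero, ← Polynomial.C_pow, mul_pow, ← Polynomial.C_pow,
        Polynomial.coeff_mul_C, Polynomial.coeff_C_mul, Polynomial.coeff_X_pow_self, mul_one]
    refine Eq.trans ?_ h1.symm
    rw [hα, hδ, ← Complex.exp_nat_mul, ← Complex.exp_nat_mul, ← Complex.exp_add]
    congr 1
    rw [Nat.cast_sub (by have := k.2; omega)]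
    push_cast
    ring

theorem torusChar_irrep (a : ℕ) (θ : ℝ) :
    (irrepRealization a).torusChar θ = torusBody a θ := by
  have h1 := sum_exp_eq_chebyshev (a + 1) θ
  have h2 := sum_exp_eq_chebyshev a θ
  rw [show ((a + 1 : ℕ) : ℤ) - 1 = a by push_cast; ring] at h1
  have hs : (irrepRealization a).torusChar θ = ∑ i : Idx a, sgn ((irrep a).parity i)
    * Complex.exp (2 * (irrepWeight a i : ℂ) * Complex.I * θ) := rfl
  have hE : ∀ k : Fin (a + 1), sgn ((irrep a).parity (Sum.inl k)) = 1 := fun _ => sgn_zero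
  have hO : ∀ r : Fin a, sgn ((irrep a).parity (Sum.inr r)) = -1 := fun _ => sgn_one
  have hw : ∀ k : Fin (a + 1), irrepWeight a (Sum.inl k) = 2 * (k : ℕ) + 1 - (a + 1 : ℕ) := by
    intro k
    simp only [irrepWeight, Sum.elim_inl]
    push_cast
    ring
  rw [hs, Fintype.sum_sum_type]
  simp only [hE, hO, hw, one_mul, neg_mul, Finset.sum_neg_distrib]
  rw [h1]
  have h3 : ∑ r : Fin a, Complex.exp (2 * (irrepWeight a (Sum.inr r) : ℂ) * Complex.I * θ) = _ := h2
  rw [h3, torusBody, charBody, Polynomial.eval_sub]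
  push_cast
  ring

/-- The realization of a tensor product of irreducible representations. -/
def listRealization : (l : List ℕ) → Realization (tensorList l)
  | [] => irrepRealization 0
  | a :: l => (irrepRealization a).tensor (listRealization l)

theorem torusChar_listRealization (l : List ℕ) (θ : ℝ) :
    (listRealization l).torusChar θ = ((l.map fun a => torusBody a θ).prod : ℝ) := by
  induction l with
  | nil =>
    rw [List.map_nil, List.prod_nil]
    refine (torusChar_irrep 0 θ).trans ?_
    simp [torusBody, charBody]
  | cons a l ih =>
    rw [List.map_cons, List.prod_cons, Complex.ofReal_mul, ← ih, ← torusChar_irrep]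
    exact Realization.torusChar_tensor _ _ θ

theorem parity_irrep (a : ℕ) (i : Idx a) :
    (irrep a).parity i = (irrepWeight a i : ZMod 2) + (a : ZMod 2) := by
  have h2 : (2 : ZMod 2) = 0 := by decide
  rcases i with i | i
  · show (0 : ZMod 2) = _
    simp [irrepWeight, h2, CharTwo.add_self_eq_zero]
  · show (1 : ZMod 2) = _
    simp [irrepWeight, h2]

/-- Parities, weights and doubled spins all add under tensor products; the shift, the sum of the
doubled spins, is the common parity of the invariants. -/
theorem parity_tensorList (l : List ℕ) (i : (tensorList l).ι) :
    (tensorList l).parity i = ((listRealization l).w i : ZMod 2) + (l.sum : ZMod 2) := by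
  induction l with
  | nil => exact parity_irrep 0 i
  | cons a l ih =>
    obtain ⟨i, k⟩ := i
    refine (congrArg₂ (· + ·) (parity_irrep a i) (ih k)).trans ?_
    show _ = ((irrepWeight a i + (listRealization l).w k : ℤ) : ZMod 2) + ((a :: l).sum : ZMod 2)
    rw [List.sum_cons]
    push_cast
    ring

theorem prod_map_punctures {p : ℕ} (a n : Fin p → ℕ) (f : ℕ → ℝ) :
    ((punctures a n).map f).prod = ∏ l, f (a l) ^ n l := by
  rw [punctures, List.map_flatten, List.prod_flatten, List.map_map, List.map_ofFn, List.prod_ofFn]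
  simp

theorem sum_punctures {p : ℕ} (a n : Fin p → ℕ) : (punctures a n).sum = ∑ l, n l * a l := by
  rw [punctures, List.sum_flatten, List.map_ofFn, List.sum_ofFn]
  simp

theorem sgn_natCast (m : ℕ) : sgn (m : ZMod 2) = (-1) ^ m := by
  induction m with
  | zero => simp [sgn_zero]
  | succ m ih => rw [Nat.cast_succ, sgn_add, ih, sgn_one, pow_succ]

theorem superNumInvariants_eq_verlindeIntegral {p : ℕ} (a n : Fin p → ℕ) :
    ((tensorList (punctures a n)).superNumInvariants : ℝ) = verlindeIntegral a n := by
  rw [(listRealization (punctures a n)).superNumInvariants_eq_integral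
    (parity_tensorList _) (f := torusProd a n) (continuous_torusProd a n),
    ← integral_eq_integral_cos_sq, integral_eq_verlindeIntegral]
  intro θ
  rw [torusChar_listRealization, prod_map_punctures]
  rfl

theorem numInvariants_eq {p : ℕ} (a n : Fin p → ℕ) :
    ((tensorList (punctures a n)).numInvariants : ℝ)
      = (-1) ^ (∑ l, n l * a l) * (tensorList (punctures a n)).superNumInvariants := by
  have h := (listRealization (punctures a n)).superNumInvariants_eq (parity_tensorList _)
  rw [sum_punctures, sgn_natCast] at h
  have h1 : ((tensorList (punctures a n)).superNumInvariants : ℝ)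
      = (-1) ^ (∑ l, n l * a l) * (tensorList (punctures a n)).numInvariants := by
    exact_mod_cast h
  rw [h1, ← mul_assoc, ← mul_pow]
  norm_num

end UOSp

end

/-! ### Counting and integration combined -/

theorem mainTheorem4 {p : ℕ} (a n : Fin p → ℕ) :
    -- the number of invariant states, counted with parity, is the super-character pairing
    (((UOSp.tensorList (UOSp.punctures a n)).superNumInvariants : ℤ) : ℂ)
        = UOSp.superScalar (UOSp.superCharacter 0) (UOSp.characterProduct a n) ∧
    -- which is the invariant integral of the product of super characters
    UOSp.superScalar (UOSp.superCharacter 0) (UOSp.characterProduct a n)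
        = UOSp.integral (UOSp.characterProduct a n) ∧
    -- and is given by the trigonometric integral formula
    UOSp.superScalar (UOSp.superCharacter 0) (UOSp.characterProduct a n)
        = (UOSp.verlindeIntegral a n : ℂ) ∧
    -- the plain number of invariant states agrees up to the sign of their common parity
    ((UOSp.tensorList (UOSp.punctures a n)).numInvariants : ℝ)
        = (-1) ^ (∑ l, n l * a l) * UOSp.verlindeIntegral a n ∧
    -- all integrals in the formula converge
    IntervalIntegrable (UOSp.mainIntegrand a n) MeasureTheory.volume 0 Real.pi ∧
    ∀ l, IntervalIntegrable (UOSp.correctionIntegrand a n l) MeasureTheory.volume 0 Real.pi := by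
  have h1 := UOSp.superScalar_superCharacter_zero (UOSp.characterProduct a n)
  have h2 := UOSp.integral_characterProduct a n
  rw [UOSp.integral_eq_verlindeIntegral] at h2
  refine ⟨?_, h1, h1.trans h2, ?_, (UOSp.continuous_mainIntegrand a n).intervalIntegrable _ _,
    fun l => (UOSp.continuous_correctionIntegrand a n l).intervalIntegrable _ _⟩
  · rw [h1, h2, ← UOSp.superNumInvariants_eq_verlindeIntegral, Complex.ofReal_intCast]
  · rw [UOSp.numInvariants_eq, UOSp.superNumInvariants_eq_verlindeIntegral]
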